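/- Let $E$ be a finite set, let $\Delta\notin E$, and let $(J_t)_{t\ge0}$ be a right-continuous Markov process on $E\cup\{\Delta\}$ with generator $$\begin{pmatrix} Q & -Q\mathbf 1\\ \mathbf 0 & 0\end{pmatrix},$$ where $Q=(q_{ij})_{i,j\in E}$ is an invertible real matrix with $q_{ij}\ge 0$ for $i\ne j$ and $-Q\mathbf 1\ge 0$ (entrywise). Let $\alpha_i=\mathbb P(J_0=i)$ for $i\in E$, $\alpha=(\alpha_i)_{i\in E}$, and $\alpha_\Delta=\mathbb P(J_0=\Delta)=1-\sum_{i\in E}\alpha_i<1$. Let $R=(r_{lj})_{l\in\{1,2\},\,j\in E}$ have nonnegative entries with $\sum_{j\in E} r_{lj}>0$ for $l=1,2$, and put $\tau=\min\{t\ge0: J_t=\Delta\}$. The joint law of $\int_0^\tau r_{1J_t}\,dt$ and $\int_0^\tau r_{2J_t}\,dt$ is denoted by $MPH^*(\alpha,Q,R)$. Put $E_0=\{i\in E: r_{1i}=0\}$, $E_+=\{i\in E: r_{1i}>0\}$, and $\eta=-Q\mathbf 1$, and write in blocks along $E=E_0\cup E_+$ $$Q=\begin{pmatrix}Q_{00}&Q_{0+}\\Q_{+0}&Q_{++}\end{pmatrix},\qquad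 \alpha=(\alpha_0,\alpha_+),\qquad \eta=\begin{pmatrix}\eta_0\\ \eta_+\end{pmatrix}.$$ Further let $R_+=\mathrm{diag}(r_{1i}:i\in E_+)$, $D_+=\mathrm{diag}(r_{2i}:i\in E_+)$, and $D_0=\mathrm{diag}(r_{2i}:i\in E_0)$. **Theorem.** Let $(Z_1,Z_2)\sim MPH^*(\alpha,Q,R)$ and $s\ge 0$. Then $sD_0-Q_{00}$ and $R_+$ are invertible, $e^{-sZ_2}$ is integrable, $$\mathbb{E}\big(e^{-sZ_2}1_{\{Z_1=0\}}\big)=\alpha_\Delta+\alpha_0\,(sD_0-Q_{00})^{-1}\eta_0 ,$$ and on $y>0$ $$\mathbb{E}\big(e^{-sZ_2}1_{\{Z_1\in dy\}}\big)=\alpha(s)\,e^{W(s)y}\,\eta(s)\,dy ,$$ that is, $y\mapsto\alpha(s)e^{W(s)y}\eta(s)$ is integrable on $(0,\infty)$ and $\mathbb{E}\big(e^{-sZ_2}1_{\{Z_1\in B\}}\big)=\int_B\alpha(s)e^{W(s)y}\eta(s)\,dy$ for every Borel set $B\subseteq(0,\infty)$. Here $$\alpha(s)=\alpha_0(sD_0-Q_{00})^{-1}Q_{0+}+\alpha_+,$$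 $$W(s)=R_+^{-1}\Big((Q_{++}-sD_+)-Q_{+0}(Q_{00}-sD_0)^{-1}Q_{0+}\Big),$$ $$\eta(s)=R_+^{-1}\Big(Q_{+0}(sD_0-Q_{00})^{-1}\eta_0+\eta_+\Big).$$ -/

import Mathlib

open MeasureTheory Filter Topology Matrix
open scoped NNReal

universe u v w

namespace Kulkarni

/-- The exit vector `η = -Q 𝟏` of a matrix `Q` indexed by the transient states. -/
def exitRate {E : Type u} [Fintype E] (Q : Matrix E E ℝ) : E → ℝ :=
  -(Q *ᵥ 1)

/-- The generator `(Q, -Q𝟏; 0, 0)` on the full state space `Option E`: the transient states are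
`some i` with `i : E`, and the absorbing state is `none`. -/
def fullGenerator {E : Type u} [Fintype E] (Q : Matrix E E ℝ) :
    Matrix (Option E) (Option E) ℝ :=
  Matrix.of fun x y =>
    match x, y with
    | some i, some j => Q i j
    | some i, none => exitRate Q i
    | none, _ => 0

/-- The initial distribution on the full state space: `α` on the transient states and the
remaining mass on the absorbing state. -/
def fullInitial {E : Type u} [Fintype E] (α : E → ℝ) : Option E → ℝ
  | some i => α i
  | none => 1 - ∑ i, α i

/-- `J` is a (time-homogeneous) Markov process in continuous time on the finite state space `S`
with generator matrix `G` and initial distribution `init`: its paths are right-continuous for the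
discrete topology on `S`, and its finite-dimensional distributions are those of the transition
semigroup `t ↦ exp (t G)` started from `init`. -/
structure IsMarkovProcess {S : Type u} [Fintype S] [DecidableEq S] (G : Matrix S S ℝ)
    (init : S → ℝ) {Ω : Type v} [MeasurableSpace Ω] (P : Measure Ω) (J : ℝ≥0 → Ω → S) :
    Prop where
  measurableSet_eq : ∀ (t : ℝ≥0) (x : S), MeasurableSet {ω | J t ω = x}
  right_continuous : ∀ (ω : Ω) (t : ℝ≥0), ∀ᶠ u in 𝓝[≥] t, J u ω = J t ω
  fdd : ∀ (n : ℕ) (t : Fin (n + 1) → ℝ≥0) (x : Fin (n + 1) → S), Monotone t → t 0 = 0 →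
    P.real {ω | ∀ i, J (t i) ω = x i} =
      init (x 0) * ∏ i : Fin n,
        NormedSpace.exp (((t i.succ : ℝ) - (t i.castSucc : ℝ)) • G) (x i.castSucc) (x i.succ)

/-- The time of absorption `min {t ≥ 0 : J t = none}` (the value on the event that absorption never
happens, which has probability zero below, is irrelevant). -/
noncomputable def absorptionTime {E : Type u} {Ω : Type v} (J : ℝ≥0 → Ω → Option E) (ω : Ω) : ℝ :=
  sInf {t : ℝ | 0 ≤ t ∧ J t.toNNReal ω = none}

/-- The total reward `∫₀^τ r (J t) dt` accumulated until absorption at reward rates `r`. -/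
noncomputable def accumulatedReward {E : Type u} {Ω : Type v} (r : E → ℝ)
    (J : ℝ≥0 → Ω → Option E) (ω : Ω) : ℝ :=
  ∫ t in (0 : ℝ)..absorptionTime J ω, (J t.toNNReal ω).elim 0 r

/-- Admissible parameters of a `k`-variate `MPH*` distribution. -/
structure IsParameter {E : Type u} [Fintype E] [DecidableEq E] {k : ℕ} (α : E → ℝ)
    (Q : Matrix E E ℝ) (R : Matrix (Fin k) E ℝ) : Prop where
  initial_nonneg : ∀ i, 0 ≤ α i
  initial_sum_le_one : ∑ i, α i ≤ 1
  initial_absorbed_lt_one : 1 - ∑ i, α i < 1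
  offDiag_nonneg : ∀ i j, i ≠ j → 0 ≤ Q i j
  exitRate_nonneg : ∀ i, 0 ≤ exitRate Q i
  isUnit_Q : IsUnit Q
  reward_nonneg : ∀ l j, 0 ≤ R l j
  reward_sum_pos : ∀ l, 0 < ∑ j, R l j

/-- `ν` is the distribution `MPH*(α, Q, R)`: the joint law of the rewards, with rates given by the
rows of `R`, accumulated until absorption by a Markov process with generator `(Q, -Q𝟏; 0, 0)` and
initial distribution `(α, 1 - α𝟏)`. -/
def IsMPHStar {E : Type u} [Fintype E] [DecidableEq E] {k : ℕ} (ν : Measure (Fin k → ℝ))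
    (α : E → ℝ) (Q : Matrix E E ℝ) (R : Matrix (Fin k) E ℝ) : Prop :=
  IsParameter α Q R ∧
    ∃ (Ω : Type v) (_ : MeasurableSpace Ω) (P : Measure Ω) (_ : IsProbabilityMeasure P)
      (J : ℝ≥0 → Ω → Option E),
      IsMarkovProcess (fullGenerator Q) (fullInitial α) P J ∧
        ν = P.map (fun ω l => accumulatedReward (R l) J ω)

section Blocks

/-- The transient states at which the reward rate `r` vanishes. -/
abbrev EZero {E : Type u} (r : E → ℝ) : Type u := {j : E // r j = 0}

/-- The transient states at which the reward rate `r` is positive. -/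
abbrev EPlus {E : Type u} (r : E → ℝ) : Type u := {j : E // 0 < r j}

variable {E : Type u} [Fintype E] [DecidableEq E]
  (α : E → ℝ) (Q : Matrix E E ℝ) (R : Matrix (Fin 2) E ℝ) (s : ℝ)

def Q00 : Matrix (EZero (R 0)) (EZero (R 0)) ℝ := Q.submatrix (fun j => j.1) (fun j => j.1)

def Q0P : Matrix (EZero (R 0)) (EPlus (R 0)) ℝ := Q.submatrix (fun j => j.1) (fun j => j.1)

def QP0 : Matrix (EPlus (R 0)) (EZero (R 0)) ℝ := Q.submatrix (fun j => j.1) (fun j => j.1)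

def QPP : Matrix (EPlus (R 0)) (EPlus (R 0)) ℝ := Q.submatrix (fun j => j.1) (fun j => j.1)

def alpha0 : EZero (R 0) → ℝ := fun j => α j.1

def alphaP : EPlus (R 0) → ℝ := fun j => α j.1

def eta0 : EZero (R 0) → ℝ := fun j => exitRate Q j.1

def etaP : EPlus (R 0) → ℝ := fun j => exitRate Q j.1

def RP : Matrix (EPlus (R 0)) (EPlus (R 0)) ℝ := Matrix.diagonal fun j => R 0 j.1

def D0 : Matrix (EZero (R 0)) (EZero (R 0)) ℝ := Matrix.diagonal fun j => R 1 j.1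

def DP : Matrix (EPlus (R 0)) (EPlus (R 0)) ℝ := Matrix.diagonal fun j => R 1 j.1

/-- The row vector `α(s) = α₀ (s D₀ - Q₀₀)⁻¹ Q₀₊ + α₊`. -/
noncomputable def alphaS : EPlus (R 0) → ℝ :=
  alpha0 α R ᵥ* ((s • D0 R - Q00 Q R)⁻¹ * Q0P Q R) + alphaP α R

/-- `W(s) = R₊⁻¹ ((Q₊₊ - s D₊) - Q₊₀ (Q₀₀ - s D₀)⁻¹ Q₀₊)`. -/
noncomputable def W : Matrix (EPlus (R 0)) (EPlus (R 0)) ℝ :=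
  (RP R)⁻¹ * ((QPP Q R - s • DP R) - QP0 Q R * (Q00 Q R - s • D0 R)⁻¹ * Q0P Q R)

/-- The column vector `η(s) = R₊⁻¹ (Q₊₀ (s D₀ - Q₀₀)⁻¹ η₀ + η₊)`. -/
noncomputable def etaS : EPlus (R 0) → ℝ :=
  (RP R)⁻¹ *ᵥ ((QP0 Q R * (s • D0 R - Q00 Q R)⁻¹) *ᵥ eta0 Q R + etaP Q R)

end Blocks

end Kulkarni

/-! Fix `s ≥ 0`. The finite measure `B ↦ E(e^{-sZ₂}; Z₁ ∈ B)` is identified through its Laplace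
transform. For `x ≥ 0`, `xZ₁ + sZ₂` has the law of the reward accumulated at the single rate vector
`k = x • R 0 + s • R 1`, so everything rests on the one-dimensional formula `E e^{-∫k(J)} = α_Δ + α
(diag k - Q)⁻¹ η` (`integral_exp_neg_accumulatedReward`). It uses only right-continuity and
finite-dimensional distributions: the reward is a limit of Riemann sums of mesh `h`, whose transform
is `init (e^{hG} diag e^{-hk})^m 1`. Splitting off a fixed vector of this matrix leaves a remainder
that decays geometrically, and a first-order expansion in `h` produces the resolvent.

Eliminating the block `E₀` turns the resolvent into a constant plus `α(s)(x - W(s))⁻¹η(s)`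
(`dotProduct_inv_mulVec_exitRate`), which is the transform of an atom plus the claimed density. The
values at natural `x` determine a finite measure on `[0, ∞)`, because polynomials in `e^{-x}`
separate points.

The linear algebra is carried by `IsStableMetzler`. The vector `-Q⁻¹𝟏` witnesses it for `Q`, and it
survives principal submatrices, subtraction of nonnegative diagonals, positive row scaling and Schur
complements, hence reaches `W(s)`. It yields a nonnegative inverse of `-A` and exponential decay of
`e^{tA}`. -/

namespace Matrix

/-! ### Matrix exponentials: series, derivatives, intertwining -/

section Exp

variable {n : Type*} [Fintype n] [DecidableEq n]

attribute [local instance] Matrix.linftyOpNormedRing Matrix.linftyOpNormedAlgebra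

theorem hasSum_exp_apply (N : Matrix n n ℝ) (i j : n) :
    HasSum (fun k : ℕ => ((k.factorial : ℝ)⁻¹) * (N ^ k) i j) (NormedSpace.exp N i j) := by
  have h := NormedSpace.exp_series_hasSum_exp' (𝕂 := ℝ) N
  have := (Pi.hasSum.1 ((Pi.hasSum.1 h) i)) j
  simp only [smul_apply, smul_eq_mul] at this
  exact this

theorem hasDerivAt_dotProduct_exp_smul_mulVec (A : Matrix n n ℝ) (a b : n → ℝ) (t : ℝ) :
    HasDerivAt (fun t : ℝ => a ⬝ᵥ (NormedSpace.exp (t • A) *ᵥ b))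
      (a ⬝ᵥ (NormedSpace.exp (t • A) *ᵥ (A *ᵥ b))) t := by
  have h := hasDerivAt_exp_smul_const A t
  have h3 : ∀ i j, HasDerivAt (fun t : ℝ => NormedSpace.exp (t • A) i j)
      ((NormedSpace.exp (t • A) * A) i j) t := fun i j =>
    hasDerivAt_pi.1 ((hasDerivAt_pi.1 h) i) j
  rw [mulVec_mulVec]
  simp only [dotProduct, mulVec]
  refine HasDerivAt.fun_sum fun i _ => HasDerivAt.const_mul _ ?_
  exact HasDerivAt.fun_sum fun j _ => (h3 i j).mul_const _

theorem continuous_dotProduct_exp_smul_mulVec (A : Matrix n n ℝ) (a b : n → ℝ) :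
    Continuous (fun t : ℝ => a ⬝ᵥ (NormedSpace.exp (t • A) *ᵥ b)) :=
  continuous_iff_continuousAt.2 fun t =>
    (hasDerivAt_dotProduct_exp_smul_mulVec A a b t).continuousAt

theorem hasDerivAt_exp_smul_apply (A : Matrix n n ℝ) (t : ℝ) (i j : n) :
    HasDerivAt (fun t : ℝ => NormedSpace.exp (t • A) i j)
      ((NormedSpace.exp (t • A) * A) i j) t := by
  have h := hasDerivAt_exp_smul_const A t
  exact hasDerivAt_pi.1 ((hasDerivAt_pi.1 h) i) j

theorem exp_sub_smul_one (N : Matrix n n ℝ) (c : ℝ) :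
    NormedSpace.exp (N - c • (1 : Matrix n n ℝ)) = Real.exp (-c) • NormedSpace.exp N := by
  rw [sub_eq_add_neg, Matrix.exp_add_of_commute]
  · have : -(c • (1 : Matrix n n ℝ)) = diagonal (fun _ => -c) := by
      ext i j; by_cases h : i = j <;> simp [h]
    rw [this, Matrix.exp_diagonal]
    ext i j
    rw [mul_diagonal]
    simp [Real.exp_eq_exp_ℝ, Pi.coe_exp, mul_comm]
  · exact ((Commute.one_right N).smul_right c).neg_right

end Exp

section Rect

variable {m n : Type*} [Fintype m] [DecidableEq m] [Fintype n] [DecidableEq n]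

theorem pow_mulVec_eq_of_intertwine {A : Matrix m m ℝ} {B : Matrix n n ℝ} {L : Matrix m n ℝ}
    (h : A * L = L * B) (k : ℕ) : A ^ k * L = L * B ^ k := by
  induction k with
  | zero => simp
  | succ k ih => rw [pow_succ, Matrix.mul_assoc, h, ← Matrix.mul_assoc, ih, Matrix.mul_assoc,
      ← pow_succ]

/-- The relation passes to all powers and so to the exponential series. A rectangular `L` lets it
serve both for an invariant subspace and, with one column, for an eigenvector. -/
theorem exp_mul_eq_of_intertwine {A : Matrix m m ℝ} {B : Matrix n n ℝ} {L : Matrix m n ℝ}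
    (h : A * L = L * B) : NormedSpace.exp A * L = L * NormedSpace.exp B := by
  ext i j
  have h1 : HasSum (fun k : ℕ => ((k.factorial : ℝ)⁻¹) * (A ^ k * L) i j)
      ((NormedSpace.exp A * L) i j) := by
    simp only [mul_apply, Finset.mul_sum, ← mul_assoc]
    exact hasSum_sum fun l _ => (hasSum_exp_apply A i l).mul_right _
  have h2 : HasSum (fun k : ℕ => ((k.factorial : ℝ)⁻¹) * (L * B ^ k) i j)
      ((L * NormedSpace.exp B) i j) := by
    simp only [mul_apply, Finset.mul_sum, mul_left_comm _ (L i _)]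
    exact hasSum_sum fun l _ => (hasSum_exp_apply B l j).mul_left _
  simp only [pow_mulVec_eq_of_intertwine h] at h1
  exact h1.unique h2

end Rect

/-! ### Nonnegative and Metzler matrices -/

section Nonneg

theorem mulVec_mono_of_nonneg {m n : Type*} [Fintype n] {N : Matrix m n ℝ}
    (hN : ∀ i j, 0 ≤ N i j) {x y : n → ℝ} (h : ∀ i, x i ≤ y i)
    (i : m) : (N *ᵥ x) i ≤ (N *ᵥ y) i :=
  Finset.sum_le_sum fun j _ => mul_le_mul_of_nonneg_left (h j) (hN i j)

theorem mulVec_nonneg_of_nonneg {m n : Type*} [Fintype n] {N : Matrix m n ℝ}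
    (hN : ∀ i j, 0 ≤ N i j) {x : n → ℝ} (h : ∀ i, 0 ≤ x i) (i : m) : 0 ≤ (N *ᵥ x) i :=
  Finset.sum_nonneg fun j _ => mul_nonneg (hN i j) (h j)

variable {n : Type*} [Fintype n] [DecidableEq n] {N : Matrix n n ℝ}

theorem pow_mulVec_le (hN : ∀ i j, 0 ≤ N i j) {v : n → ℝ} {c : ℝ} (hc : 0 ≤ c)
    (h : ∀ i, (N *ᵥ v) i ≤ c * v i) (k : ℕ) (i : n) : (N ^ k *ᵥ v) i ≤ c ^ k * v i := by
  induction k generalizing i with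
  | zero => simp
  | succ k ih =>
    rw [pow_succ', ← mulVec_mulVec]
    calc (N *ᵥ (N ^ k *ᵥ v)) i ≤ (N *ᵥ (c ^ k • v)) i := mulVec_mono_of_nonneg hN ih i
      _ = c ^ k * (N *ᵥ v) i := by rw [mulVec_smul]; simp
      _ ≤ c ^ k * (c * v i) := mul_le_mul_of_nonneg_left (h i) (pow_nonneg hc k)
      _ = c ^ (k + 1) * v i := by ring

theorem exp_apply_nonneg (hN : ∀ i j, 0 ≤ N i j) (i j : n) : 0 ≤ NormedSpace.exp N i j :=
  (hasSum_exp_apply N i j).nonneg fun k =>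
    mul_nonneg (by positivity) (pow_apply_nonneg hN k i j)

theorem exp_mulVec_le (hN : ∀ i j, 0 ≤ N i j) {v : n → ℝ} {c : ℝ} (hc : 0 ≤ c)
    (h : ∀ i, (N *ᵥ v) i ≤ c * v i) (i : n) :
    (NormedSpace.exp N *ᵥ v) i ≤ Real.exp c * v i := by
  have h1 : HasSum (fun k : ℕ => ((k.factorial : ℝ)⁻¹) * (N ^ k *ᵥ v) i)
      ((NormedSpace.exp N *ᵥ v) i) := by
    simp only [mulVec, dotProduct, Finset.mul_sum, ← mul_assoc]
    exact hasSum_sum fun l _ => (hasSum_exp_apply N i l).mul_right _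
  have h2 : HasSum (fun k : ℕ => ((k.factorial : ℝ)⁻¹) * (c ^ k * v i))
      (Real.exp c * v i) := by
    have := (NormedSpace.exp_series_hasSum_exp' (𝕂 := ℝ) c).mul_right (v i)
    simpa [Real.exp_eq_exp_ℝ, mul_assoc] using this
  exact hasSum_le (fun k => mul_le_mul_of_nonneg_left (pow_mulVec_le hN hc h k i) (by positivity))
    h1 h2

/-- A matrix with nonnegative off-diagonal entries, shifted to a nonnegative matrix. -/
theorem exists_add_smul_one_nonneg {A : Matrix n n ℝ} (hA : ∀ i j, i ≠ j → 0 ≤ A i j) (d : ℝ) :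
    ∃ c, d ≤ c ∧ ∀ i j, 0 ≤ (A + c • (1 : Matrix n n ℝ)) i j := by
  refine ⟨|d| + ∑ i, |A i i|, ?_, fun i j => ?_⟩
  · have : 0 ≤ ∑ i, |A i i| := Finset.sum_nonneg fun i _ => abs_nonneg _
    linarith [le_abs_self d]
  · by_cases h : i = j
    · subst h
      have : |A i i| ≤ ∑ i, |A i i| :=
        Finset.single_le_sum (f := fun i => |A i i|) (fun i _ => abs_nonneg _) (Finset.mem_univ i)
      simp
      linarith [neg_abs_le (A i i), abs_nonneg d]
    · simpa [one_apply, h] using hA i j h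

theorem exp_smul_apply_nonneg {A : Matrix n n ℝ} (hA : ∀ i j, i ≠ j → 0 ≤ A i j) {t : ℝ}
    (ht : 0 ≤ t) (i j : n) : 0 ≤ NormedSpace.exp (t • A) i j := by
  obtain ⟨c, -, hc⟩ := exists_add_smul_one_nonneg hA 0
  have : t • A = t • (A + c • (1 : Matrix n n ℝ)) - (t * c) • (1 : Matrix n n ℝ) := by
    rw [smul_add, smul_smul]; abel
  rw [this, exp_sub_smul_one]
  exact mul_nonneg (Real.exp_pos _).le
    (exp_apply_nonneg (fun i j => mul_nonneg ht (hc i j)) i j)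

end Nonneg

/-- A Metzler matrix `A` (nonnegative off the diagonal) for which the positive vector `v`
satisfies `A v < 0`. Such matrices are the negatives of nonsingular M-matrices. -/
structure IsStableMetzler {n : Type*} [Fintype n] (A : Matrix n n ℝ) (v : n → ℝ) : Prop where
  offDiag_nonneg : ∀ i j, i ≠ j → 0 ≤ A i j
  pos : ∀ i, 0 < v i
  mulVec_neg : ∀ i, (A *ᵥ v) i < 0

namespace IsStableMetzler

variable {n : Type*} [Fintype n] [DecidableEq n] {A : Matrix n n ℝ} {v : n → ℝ}

/-- Minimum principle: let `k` minimise `x i / v i`, with minimum `c`. As `x - c v` is nonnegative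
and vanishes at `k`, `(A x) k ≥ c (A v) k`, which would be positive if `c < 0`. -/
theorem nonneg_of_mulVec_nonpos (h : IsStableMetzler A v) {x : n → ℝ}
    (hx : ∀ i, (A *ᵥ x) i ≤ 0) (i : n) : 0 ≤ x i := by
  have : Nonempty n := ⟨i⟩
  obtain ⟨k, hk⟩ := Finite.exists_min fun i => x i / v i
  set c := x k / v k with hc
  have hxc : ∀ j, c * v j ≤ x j := fun j => (le_div_iff₀ (h.pos j)).1 (hk j)
  by_contra! hi
  have hc0 : c < 0 := lt_of_le_of_lt (hk i) (div_neg_of_neg_of_pos hi (h.pos i))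
  have hkk : x k = c * v k := by rw [hc, div_mul_cancel₀ _ (h.pos k).ne']
  have h1 : 0 ≤ (A *ᵥ x) k - c * (A *ᵥ v) k := by
    have : (A *ᵥ x) k - c * (A *ᵥ v) k = ∑ j, A k j * (x j - c * v j) := by
      simp only [mulVec, dotProduct, Finset.mul_sum, ← Finset.sum_sub_distrib]
      exact Finset.sum_congr rfl fun j _ => by ring
    rw [this]
    refine Finset.sum_nonneg fun j _ => ?_
    by_cases hj : k = j
    · subst hj; simp [hkk]
    · exact mul_nonneg (h.offDiag_nonneg k j hj) (sub_nonneg.2 (hxc j))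
  have h2 := mul_pos_of_neg_of_neg hc0 (h.mulVec_neg k)
  linarith [hx k]

theorem isUnit (h : IsStableMetzler A v) : IsUnit A := by
  rw [← mulVec_injective_iff_isUnit]
  intro x y hxy
  have e : A *ᵥ (x - y) = 0 := by rw [mulVec_sub]; exact sub_eq_zero.2 hxy
  have h1 := h.nonneg_of_mulVec_nonpos (x := x - y) (fun i => by simp [e])
  have h2 := h.nonneg_of_mulVec_nonpos (x := -(x - y)) (fun i => by rw [Matrix.mulVec_neg, e]; simp)
  ext i
  have := h1 i; have := h2 i
  simp at *
  linarith

theorem isUnit_neg (h : IsStableMetzler A v) : IsUnit (-A) := h.isUnit.neg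

theorem neg_inv_mulVec_nonneg (h : IsStableMetzler A v) {b : n → ℝ} (hb : ∀ i, 0 ≤ b i) (i : n) :
    0 ≤ ((-A)⁻¹ *ᵥ b) i := by
  refine h.nonneg_of_mulVec_nonpos (fun i => ?_) i
  have : A *ᵥ ((-A)⁻¹ *ᵥ b) = -b := by
    have h1 : (-A) *ᵥ ((-A)⁻¹ *ᵥ b) = b := by
      rw [mulVec_mulVec, mul_nonsing_inv _ ((isUnit_iff_isUnit_det _).1 h.isUnit_neg), one_mulVec]
    rw [neg_mulVec] at h1
    exact (neg_eq_iff_eq_neg.1 h1)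
  simp [this, hb i]

theorem neg_inv_apply_nonneg (h : IsStableMetzler A v) (i j : n) : 0 ≤ (-A)⁻¹ i j := by
  have := h.neg_inv_mulVec_nonneg (b := Pi.single j 1)
    (fun k => by by_cases hk : k = j <;> simp [hk]) i
  simpa using this

theorem exp_smul_apply_nonneg (h : IsStableMetzler A v) {t : ℝ} (ht : 0 ≤ t) (i j : n) :
    0 ≤ NormedSpace.exp (t • A) i j :=
  Matrix.exp_smul_apply_nonneg h.offDiag_nonneg ht i j

/-- Finiteness of the index set upgrades `A v < 0` to `A v ≤ -δ v`. For the nonnegative shift `A +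
c` this reads `(A + c) v ≤ (c - δ) v`, which passes termwise to the exponential series; the factor
`e^{-tc}` then undoes the shift. -/
theorem exists_exp_smul_mulVec_le (h : IsStableMetzler A v) :
    ∃ δ > 0, ∀ t : ℝ, 0 ≤ t → ∀ i,
      (NormedSpace.exp (t • A) *ᵥ v) i ≤ Real.exp (-(δ * t)) * v i := by
  obtain ⟨δ, hδ, hAv⟩ : ∃ δ > 0, ∀ i, (A *ᵥ v) i ≤ -δ * v i := by
    cases isEmpty_or_nonempty n
    · exact ⟨1, one_pos, fun i => isEmptyElim i⟩
    obtain ⟨k, hk⟩ := Finite.exists_min fun i => -(A *ᵥ v) i / v i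
    refine ⟨_, div_pos (neg_pos.2 (h.mulVec_neg k)) (h.pos k), fun i => ?_⟩
    have := (le_div_iff₀ (h.pos i)).1 (hk i)
    linarith
  refine ⟨δ, hδ, fun t ht i => ?_⟩
  -- The shift is chosen with `δ ≤ c` so that the growth constant `t * (c - δ)` is nonnegative.
  obtain ⟨c, hdc, hc⟩ := exists_add_smul_one_nonneg h.offDiag_nonneg δ
  have e : t • A = t • (A + c • (1 : Matrix n n ℝ)) - (t * c) • (1 : Matrix n n ℝ) := by
    rw [smul_add, smul_smul]; abel
  rw [e, exp_sub_smul_one, smul_mulVec]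
  have := exp_mulVec_le (N := t • (A + c • (1 : Matrix n n ℝ))) (v := v) (c := t * (c - δ))
    (fun i j => mul_nonneg ht (hc i j)) (mul_nonneg ht (by linarith)) (fun i => by
      have h1 : ((t • (A + c • (1 : Matrix n n ℝ))) *ᵥ v) i = t * ((A *ᵥ v) i + c * v i) := by
        simp [smul_mulVec, add_mulVec, mul_add]
      rw [h1, mul_assoc]
      exact mul_le_mul_of_nonneg_left (by linarith [hAv i]) ht) i
  calc Real.exp (-(t * c)) * (NormedSpace.exp (t • (A + c • (1 : Matrix n n ℝ))) *ᵥ v) i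
      ≤ Real.exp (-(t * c)) * (Real.exp (t * (c - δ)) * v i) :=
        mul_le_mul_of_nonneg_left this (Real.exp_pos _).le
    _ = Real.exp (-(δ * t)) * v i := by
        rw [← mul_assoc, ← Real.exp_add]; congr 2; ring

theorem exists_abs_exp_smul_apply_le (h : IsStableMetzler A v) :
    ∃ δ > 0, ∃ C, ∀ t : ℝ, 0 ≤ t → ∀ i j,
      |NormedSpace.exp (t • A) i j| ≤ C * Real.exp (-δ * t) := by
  obtain ⟨δ, hδ, hb⟩ := h.exists_exp_smul_mulVec_le
  refine ⟨δ, hδ, ∑ i, ∑ j, v i / v j, fun t ht i j => ?_⟩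
  have h0 := h.exp_smul_apply_nonneg ht
  rw [abs_of_nonneg (h0 i j)]
  have h1 : NormedSpace.exp (t • A) i j * v j ≤ Real.exp (-(δ * t)) * v i :=
    (Finset.single_le_sum (f := fun j => NormedSpace.exp (t • A) i j * v j)
      (fun j _ => mul_nonneg (h0 i j) (h.pos j).le) (Finset.mem_univ j)).trans (hb t ht i)
  have h2 : v i / v j ≤ ∑ i, ∑ j, v i / v j :=
    (Finset.single_le_sum (f := fun j => v i / v j)
      (fun j _ => (div_pos (h.pos i) (h.pos j)).le) (Finset.mem_univ j)).trans
    (Finset.single_le_sum (f := fun i => ∑ j, v i / v j)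
      (fun i _ => Finset.sum_nonneg fun j _ => (div_pos (h.pos i) (h.pos j)).le)
      (Finset.mem_univ i))
  calc NormedSpace.exp (t • A) i j ≤ Real.exp (-(δ * t)) * v i / v j :=
        (le_div_iff₀ (h.pos j)).2 h1
    _ = (v i / v j) * Real.exp (-δ * t) := by rw [neg_mul]; ring
    _ ≤ _ := mul_le_mul_of_nonneg_right h2 (Real.exp_pos _).le

theorem exists_abs_dotProduct_exp_le (h : IsStableMetzler A v) (a b : n → ℝ) :
    ∃ δ > 0, ∃ C, ∀ t : ℝ, 0 ≤ t →
      |a ⬝ᵥ (NormedSpace.exp (t • A) *ᵥ b)| ≤ C * Real.exp (-δ * t) := by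
  obtain ⟨δ, hδ, C, hC⟩ := h.exists_abs_exp_smul_apply_le
  refine ⟨δ, hδ, ∑ i, ∑ j, |a i| * (C * |b j|), fun t ht => ?_⟩
  simp only [dotProduct, mulVec, Finset.mul_sum, Finset.sum_mul]
  refine (Finset.abs_sum_le_sum_abs _ _).trans (Finset.sum_le_sum fun i _ => ?_)
  refine (Finset.abs_sum_le_sum_abs _ _).trans (Finset.sum_le_sum fun j _ => ?_)
  rw [abs_mul, abs_mul, mul_assoc]
  refine mul_le_mul_of_nonneg_left ?_ (abs_nonneg _)
  calc _ ≤ (C * Real.exp (-δ * t)) * |b j| :=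
        mul_le_mul_of_nonneg_right (hC t ht i j) (abs_nonneg _)
    _ = _ := by ring

theorem integrableOn_dotProduct_exp (h : IsStableMetzler A v) (a b : n → ℝ) :
    IntegrableOn (fun t : ℝ => a ⬝ᵥ (NormedSpace.exp (t • A) *ᵥ b)) (Set.Ioi 0) := by
  obtain ⟨δ, hδ, C, hC⟩ := h.exists_abs_dotProduct_exp_le a b
  refine Integrable.mono' ((exp_neg_integrableOn_Ioi 0 hδ).const_mul C)
    (continuous_dotProduct_exp_smul_mulVec A a b).aestronglyMeasurable ?_
  refine (ae_restrict_iff' measurableSet_Ioi).2 (.of_forall fun t ht => ?_)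
  exact hC t (le_of_lt ht)

/-- The integrand is the derivative of `a e^{tA} A⁻¹ b`, with `A⁻¹` written as `-(-A)⁻¹`, and this
primitive vanishes at infinity. -/
theorem integral_dotProduct_exp (h : IsStableMetzler A v) (a b : n → ℝ) :
    ∫ t in Set.Ioi (0 : ℝ), a ⬝ᵥ (NormedSpace.exp (t • A) *ᵥ b) = a ⬝ᵥ ((-A)⁻¹ *ᵥ b) := by
  have hd := (isUnit_iff_isUnit_det _).1 h.isUnit_neg
  have hAb : A *ᵥ (-((-A)⁻¹ *ᵥ b)) = b := by
    have h1 : (-A) *ᵥ ((-A)⁻¹ *ᵥ b) = b := by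
      rw [mulVec_mulVec, mul_nonsing_inv _ hd, one_mulVec]
    rw [Matrix.mulVec_neg, ← neg_mulVec, h1]
  have hder : ∀ t : ℝ, HasDerivAt
      (fun t : ℝ => a ⬝ᵥ (NormedSpace.exp (t • A) *ᵥ (-((-A)⁻¹ *ᵥ b))))
      (a ⬝ᵥ (NormedSpace.exp (t • A) *ᵥ b)) t := fun t => by
    have := hasDerivAt_dotProduct_exp_smul_mulVec A a (-((-A)⁻¹ *ᵥ b)) t
    rwa [hAb] at this
  have hlim : Tendsto (fun t : ℝ => a ⬝ᵥ (NormedSpace.exp (t • A) *ᵥ (-((-A)⁻¹ *ᵥ b)))) atTop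
      (𝓝 0) := by
    obtain ⟨δ, hδ, C, hC⟩ := h.exists_abs_dotProduct_exp_le a (-((-A)⁻¹ *ᵥ b))
    have h0 : Tendsto (fun t : ℝ => C * Real.exp (-δ * t)) atTop (𝓝 0) := by
      have := (Real.tendsto_exp_atBot.comp
        (tendsto_id.const_mul_atTop_of_neg (neg_neg_of_pos hδ))).const_mul C
      simpa using this
    refine squeeze_zero_norm' ?_ h0
    filter_upwards [eventually_ge_atTop 0] with t ht using hC t ht
  rw [integral_Ioi_of_hasDerivAt_of_tendsto' (fun t _ => hder t)
    (h.integrableOn_dotProduct_exp a b) hlim]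
  simp [NormedSpace.exp_zero]

theorem sub_diagonal (h : IsStableMetzler A v) {k : n → ℝ} (hk : ∀ i, 0 ≤ k i) :
    IsStableMetzler (A - diagonal k) v where
  offDiag_nonneg i j hij := by simpa [diagonal_apply, hij] using h.offDiag_nonneg i j hij
  pos := h.pos
  mulVec_neg i := by
    rw [sub_mulVec, Pi.sub_apply, mulVec_diagonal]
    linarith [h.mulVec_neg i, mul_nonneg (hk i) (h.pos i).le]

theorem diagonal_mul (h : IsStableMetzler A v) {k : n → ℝ} (hk : ∀ i, 0 < k i) :
    IsStableMetzler (diagonal k * A) v where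
  offDiag_nonneg i j hij := by
    rw [Matrix.diagonal_mul]; exact mul_nonneg (hk i).le (h.offDiag_nonneg i j hij)
  pos := h.pos
  mulVec_neg i := by
    rw [← mulVec_mulVec, mulVec_diagonal]
    exact mul_neg_of_pos_of_neg (hk i) (h.mulVec_neg i)

end IsStableMetzler

end Matrix

/-! ### Uniqueness of Laplace transforms -/

namespace MeasureTheory.Measure

open _root_.BoundedContinuousFunction in
/-- Finite measures on `ℝ≥0` are determined by their Laplace transforms at natural numbers. -/
theorem ext_of_integral_exp_neg_nat {μ ν : Measure ℝ≥0} [IsFiniteMeasure μ] [IsFiniteMeasure ν]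
    (h : ∀ n : ℕ, ∫ x : ℝ≥0, Real.exp (-(n * x)) ∂μ = ∫ x : ℝ≥0, Real.exp (-(n * x)) ∂ν) :
    μ = ν := by
  let g : ℝ≥0 →ᵇ ℝ := BoundedContinuousFunction.ofNormedAddCommGroup
    (fun x : ℝ≥0 => Real.exp (-(x : ℝ))) (by fun_prop) 1 (fun x => by
      rw [Real.norm_eq_abs, abs_of_pos (Real.exp_pos _)]
      exact Real.exp_le_one_iff.2 (by simp))
  have hg : ∀ x, g x = Real.exp (-(x : ℝ)) := fun x => rfl
  -- Polynomials in `g = e^{-x}`: this algebra separates points since `g` is injective, and on the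
  -- monomial `gⁿ` the two integrals agree by hypothesis, `n = 0` being the total mass.
  let A : StarSubalgebra ℝ (ℝ≥0 →ᵇ ℝ) :=
    { (Polynomial.aeval (R := ℝ) g).range with
      star_mem' := fun {a} ha => by
        have : star a = a := by ext x; simp
        rw [this]; exact ha }
  have hA : ∀ p : Polynomial ℝ, Polynomial.aeval g p ∈ A := fun p => ⟨p, rfl⟩
  refine ext_of_forall_mem_subalgebra_integral_eq_of_polish (𝕜 := ℝ) (A := A) ?_ ?_
  · intro x y hxy
    refine ⟨g, ⟨(toContinuousMapStarₐ ℝ g), ⟨g, ?_, rfl⟩, rfl⟩, ?_⟩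
    · simpa using hA Polynomial.X
    · rw [hg, hg]
      intro h
      exact hxy (NNReal.coe_injective (neg_injective (Real.exp_injective h)))
  · rintro f ⟨p, rfl⟩
    have hint : ∀ (ρ : Measure ℝ≥0) [IsFiniteMeasure ρ] (f : ℝ≥0 →ᵇ ℝ), Integrable f ρ :=
      fun ρ _ f => f.integrable ρ
    induction p using Polynomial.induction_on' with
    | add p q hp hq =>
      have e : ∀ x, (Polynomial.aeval g (p + q)) x
          = (Polynomial.aeval g p) x + (Polynomial.aeval g q) x := fun x => by simp
      change ∫ x, (Polynomial.aeval g (p + q)) x ∂μ = ∫ x, (Polynomial.aeval g (p + q)) x ∂ν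
      simp only [e]
      rw [integral_add (hint _ _) (hint _ _), integral_add (hint _ _) (hint _ _)]
      exact congrArg₂ (· + ·) hp hq
    | monomial n a =>
      have e : ∀ x : ℝ≥0, (Polynomial.aeval g (Polynomial.monomial n a)) x
          = a * Real.exp (-(n * x)) := fun x => by
        rw [Polynomial.aeval_monomial, ← mul_neg, Real.exp_nat_mul, ← hg]
        simp [Algebra.algebraMap_eq_smul_one]
      change ∫ x, (Polynomial.aeval g (Polynomial.monomial n a)) x ∂μ
        = ∫ x, (Polynomial.aeval g (Polynomial.monomial n a)) x ∂ν
      simp only [e, integral_const_mul, h]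

/-- Finite measures on `ℝ` concentrated on `[0, ∞)` are determined by their Laplace transforms at
natural numbers. -/
theorem ext_of_integral_exp_neg_nat_of_nonneg {μ ν : Measure ℝ} [IsFiniteMeasure μ]
    [IsFiniteMeasure ν] (hμ : ∀ᵐ x ∂μ, 0 ≤ x) (hν : ∀ᵐ x ∂ν, 0 ≤ x)
    (h : ∀ n : ℕ, ∫ x, Real.exp (-(n * x)) ∂μ = ∫ x, Real.exp (-(n * x)) ∂ν) : μ = ν := by
  have hm : Measurable Real.toNNReal := measurable_real_toNNReal
  have hi : ∀ (ρ : Measure ℝ), (∀ᵐ x ∂ρ, 0 ≤ x) → ∀ n : ℕ,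
      ∫ x : ℝ≥0, Real.exp (-(n * x)) ∂(ρ.map Real.toNNReal) = ∫ x, Real.exp (-(n * x)) ∂ρ := by
    intro ρ hρ n
    rw [integral_map hm.aemeasurable (by fun_prop)]
    refine integral_congr_ae ?_
    filter_upwards [hρ] with x hx
    simp [hx]
  have hb : ∀ (ρ : Measure ℝ), (∀ᵐ x ∂ρ, 0 ≤ x) →
      (ρ.map Real.toNNReal).map ((↑) : ℝ≥0 → ℝ) = ρ := by
    intro ρ hρ
    rw [Measure.map_map measurable_coe_nnreal_real hm]
    conv_rhs => rw [← Measure.map_id (μ := ρ)]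
    refine Measure.map_congr ?_
    filter_upwards [hρ] with x hx
    simp [hx]
  rw [← hb μ hμ, ← hb ν hν]
  congr 1
  refine ext_of_integral_exp_neg_nat fun n => ?_
  rw [hi μ hμ, hi ν hν, h n]

end MeasureTheory.Measure

/-! ### Riemann sums and accumulated rewards -/

/-- Riemann sums at right endpoints converge to the integral of a bounded right-continuous
function that vanishes eventually. -/
theorem tendsto_riemannSum_of_right_continuous {g : ℝ≥0 → ℝ}
    (hg : ∀ t, ContinuousWithinAt g (Set.Ici t) t) {C : ℝ} (hC : ∀ t, |g t| ≤ C) {N : ℕ}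
    (hN : ∀ t : ℝ≥0, (N : ℝ≥0) ≤ t → g t = 0) :
    Tendsto (fun n : ℕ => ((n : ℝ) + 1)⁻¹ *
        ∑ i ∈ Finset.range ((n + 1) ^ 2), g (((i : ℝ≥0) + 1) / ((n : ℝ≥0) + 1))) atTop
      (𝓝 (∫ t in (0 : ℝ)..N, g t.toNNReal)) := by
  -- Step function with the value of `g` at the right endpoint of the cell containing `t`. Rounding
  -- up makes the sample points approach `t` from the right, where `g` is continuous.
  let F : ℕ → ℝ → ℝ := fun n t => g ((⌈((n : ℝ) + 1) * t⌉₊ : ℝ≥0) / ((n : ℝ≥0) + 1))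
  have hFm : ∀ n, Measurable (F n) := fun n =>
    (measurable_from_top (f := fun k : ℕ => g ((k : ℝ≥0) / ((n : ℝ≥0) + 1)))).comp
      (Nat.measurable_ceil.comp (measurable_const.mul measurable_id))
  have hFi : ∀ n a b, IntervalIntegrable (F n) volume a b := fun n a b =>
    (intervalIntegrable_const (c := C)).mono_fun (hFm n).aestronglyMeasurable
      (.of_forall fun t => by
        simpa using (hC _).trans (le_abs_self C))
  have hlim : Tendsto (fun n => ∫ t in (0 : ℝ)..N, F n t) atTop
      (𝓝 (∫ t in (0 : ℝ)..N, g t.toNNReal)) := by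
    refine intervalIntegral.tendsto_integral_filter_of_dominated_convergence (fun _ => C)
      (.of_forall fun n => (hFm n).aestronglyMeasurable)
      (.of_forall fun n => .of_forall fun t _ => hC _) (by simp) (.of_forall fun t ht => ?_)
    rw [Set.uIoc_of_le (Nat.cast_nonneg N)] at ht
    have ht0 : 0 ≤ t := ht.1.le
    have hpos : ∀ n : ℕ, (0 : ℝ) < n + 1 := fun n => by positivity
    refine (hg t.toNNReal).tendsto.comp (tendsto_nhdsWithin_iff.2 ⟨?_, .of_forall fun n => ?_⟩)
    · rw [← NNReal.tendsto_coe]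
      have h1 : Tendsto (fun n : ℕ => t + 1 / ((n : ℝ) + 1)) atTop (𝓝 (t + 0)) :=
        tendsto_const_nhds.add tendsto_one_div_add_atTop_nhds_zero_nat
      rw [add_zero] at h1
      simp only [Real.coe_toNNReal t ht0]
      refine tendsto_of_tendsto_of_tendsto_of_le_of_le tendsto_const_nhds h1 (fun n => ?_)
        (fun n => ?_)
      · have := Nat.le_ceil (((n : ℝ) + 1) * t)
        simp only [NNReal.coe_div, NNReal.coe_natCast, NNReal.coe_add, NNReal.coe_one]
        rw [le_div_iff₀ (hpos n)]; linarith
      · have := (Nat.ceil_lt_add_one (mul_nonneg (hpos n).le ht0)).le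
        simp only [NNReal.coe_div, NNReal.coe_natCast, NNReal.coe_add, NNReal.coe_one]
        have h2 : (t + 1 / ((n : ℝ) + 1)) * (n + 1) = ((n : ℝ) + 1) * t + 1 := by
          field_simp
        rw [div_le_iff₀ (hpos n), h2]; exact this
    · rw [Set.mem_Ici, ← NNReal.coe_le_coe, Real.coe_toNNReal t ht0]
      have := Nat.le_ceil (((n : ℝ) + 1) * t)
      simp only [NNReal.coe_div, NNReal.coe_natCast, NNReal.coe_add, NNReal.coe_one]
      rw [le_div_iff₀ (hpos n)]; linarith
  refine hlim.congr' ?_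
  filter_upwards [eventually_ge_atTop N] with n hn
  have hpos : (0 : ℝ) < n + 1 := by positivity
  have hpos' : (0 : ℝ≥0) < n + 1 := by positivity
  -- Once `n ≥ N` the sum reaches past time `N`, and the terms with index from `(n + 1) * N` on
  -- vanish; what remains is exactly the integral of `F n` over `[0, N]`.
  have hsub : Finset.range ((n + 1) * N) ⊆ Finset.range ((n + 1) ^ 2) := by
    rw [Finset.range_subset_range]; nlinarith
  rw [← Finset.sum_subset hsub (fun i _ hi => hN _ (by
    rw [Finset.mem_range, not_lt] at hi
    rw [le_div_iff₀ hpos']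
    have : (((n + 1) * N : ℕ) : ℝ≥0) ≤ i := Nat.cast_le.2 hi
    push_cast at this
    calc (N : ℝ≥0) * (n + 1) = (n + 1) * N := mul_comm _ _
      _ ≤ i := this
      _ ≤ i + 1 := le_self_add)), Finset.mul_sum]
  have hsum := intervalIntegral.sum_integral_adjacent_intervals (f := F n) (μ := volume)
    (a := fun i : ℕ => (i : ℝ) / ((n : ℝ) + 1)) (n := (n + 1) * N) (fun k _ => hFi n _ _)
  have e0 : ((0 : ℕ) : ℝ) / ((n : ℝ) + 1) = 0 := by simp
  have eN : (((n + 1) * N : ℕ) : ℝ) / ((n : ℝ) + 1) = N := by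
    push_cast; field_simp
  rw [e0, eN] at hsum
  rw [← hsum]
  refine Finset.sum_congr rfl fun i _ => ?_
  have hle : (i : ℝ) / (n + 1) ≤ ((i + 1 : ℕ) : ℝ) / (n + 1) := by
    gcongr; simp
  have : ∫ t in ((i : ℝ) / (n + 1))..(((i + 1 : ℕ) : ℝ) / (n + 1)), F n t
      = ∫ t in ((i : ℝ) / (n + 1))..(((i + 1 : ℕ) : ℝ) / (n + 1)),
        g (((i : ℝ≥0) + 1) / ((n : ℝ≥0) + 1)) := by
    refine intervalIntegral.integral_congr_ae (.of_forall fun t ht => ?_)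
    rw [Set.uIoc_of_le hle] at ht
    have hceil : ⌈((n : ℝ) + 1) * t⌉₊ = i + 1 := by
      rw [Nat.ceil_eq_iff (Nat.succ_ne_zero i)]
      have h1 := (div_lt_iff₀ hpos).1 ht.1
      have h2 := (le_div_iff₀ hpos).1 ht.2
      push_cast at h2 ⊢
      constructor <;> linarith
    simp only [F, hceil]
    push_cast
    rfl
  rw [this, intervalIntegral.integral_const, smul_eq_mul]
  congr 1
  push_cast
  field_simp
  ring

namespace Kulkarni

variable {E : Type u} {Ω : Type v} {J : ℝ≥0 → Ω → Option E} {ω : Ω}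

theorem absorptionTime_nonneg (J : ℝ≥0 → Ω → Option E) (ω : Ω) : 0 ≤ absorptionTime J ω :=
  Real.sInf_nonneg fun _ ht => ht.1

theorem accumulatedReward_nonneg {r : E → ℝ} (hr : ∀ i, 0 ≤ r i) (J : ℝ≥0 → Ω → Option E)
    (ω : Ω) : 0 ≤ accumulatedReward r J ω :=
  intervalIntegral.integral_nonneg (absorptionTime_nonneg J ω) fun t _ => by
    cases J t.toNNReal ω with
    | none => exact le_rfl
    | some i => exact hr i

/-- After absorption the integrand is zero, so the random upper limit can be replaced by any integer
time by which the path is absorbed. -/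
theorem accumulatedReward_eq_integral (habs : ∀ a b : ℝ≥0, a ≤ b → J a ω = none → J b ω = none)
    {N : ℕ} (hN : J N ω = none) (r : E → ℝ) :
    accumulatedReward r J ω = ∫ t in (0 : ℝ)..N, (J t.toNNReal ω).elim 0 r := by
  set τ := absorptionTime J ω with hτ
  have hτ0 : 0 ≤ τ := absorptionTime_nonneg J ω
  have hmem : (N : ℝ) ∈ {t : ℝ | 0 ≤ t ∧ J t.toNNReal ω = none} :=
    ⟨Nat.cast_nonneg N, by simpa using hN⟩
  have hτN : τ ≤ N := csInf_le ⟨0, fun t ht => ht.1⟩ hmem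
  rw [accumulatedReward, ← hτ, intervalIntegral.integral_of_le hτ0,
    intervalIntegral.integral_of_le (hτ0.trans hτN)]
  refine (setIntegral_eq_of_subset_of_forall_sdiff_eq_zero measurableSet_Ioc
    (Set.Ioc_subset_Ioc_right hτN) fun t ht => ?_).symm
  have hlt : τ < t := by
    by_contra! h
    exact ht.2 ⟨ht.1.1, h⟩
  obtain ⟨a, ha, hat⟩ := exists_lt_of_csInf_lt ⟨_, hmem⟩ hlt
  rw [habs a.toNNReal t.toNNReal (Real.toNNReal_le_toNNReal hat.le) ha.2]
  rfl

theorem tendsto_riemannSum_accumulatedReward [Fintype E]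
    (hrc : ∀ t : ℝ≥0, ∀ᶠ u in 𝓝[≥] t, J u ω = J t ω)
    (habs : ∀ a b : ℝ≥0, a ≤ b → J a ω = none → J b ω = none)
    {N : ℕ} (hN : J N ω = none) (r : E → ℝ) :
    Tendsto (fun n : ℕ => ((n : ℝ) + 1)⁻¹ * ∑ i ∈ Finset.range ((n + 1) ^ 2),
        (J (((i : ℝ≥0) + 1) / ((n : ℝ≥0) + 1)) ω).elim 0 r) atTop
      (𝓝 (accumulatedReward r J ω)) := by
  rw [accumulatedReward_eq_integral habs hN]
  refine tendsto_riemannSum_of_right_continuous (g := fun t => (J t ω).elim 0 r) (fun t => ?_)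
    (C := ∑ i, |r i|) (fun t => ?_) (fun t ht => ?_)
  · exact tendsto_nhds_of_eventually_eq ((hrc t).mono fun u hu => by rw [hu])
  · have h0 : 0 ≤ ∑ i, |r i| := Finset.sum_nonneg fun i _ => abs_nonneg _
    cases J t ω with
    | none => simpa using h0
    | some i =>
      exact Finset.single_le_sum (f := fun i => |r i|) (fun i _ => abs_nonneg (r i))
        (Finset.mem_univ i)
  · rw [habs _ _ ht hN]
    rfl

end Kulkarni

/-! ### Path sums, limits of inverses, stability from row sums -/

namespace Matrix

/-- Induction on the length, absorbing the first step into the initial vector; this is why `a` is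
generalised. -/
theorem sum_prod_path_eq {S : Type*} [Fintype S] [DecidableEq S] (M : Matrix S S ℝ) (m : ℕ)
    (a : S → ℝ) :
    ∑ x : Fin (m + 1) → S, a (x 0) * ∏ i : Fin m, M (x i.castSucc) (x i.succ)
      = a ⬝ᵥ (M ^ m *ᵥ 1) := by
  induction m generalizing a with
  | zero =>
    rw [← (Equiv.funUnique (Fin 1) S).symm.sum_comp]
    simp [dotProduct]
  | succ m ih =>
    rw [pow_succ', ← mulVec_mulVec, dotProduct_mulVec, ← ih,
      ← (Fin.consEquiv fun _ : Fin (m + 2) => S).sum_comp, Fintype.sum_prod_type, Finset.sum_comm]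
    refine Finset.sum_congr rfl fun x _ => ?_
    simp only [vecMul, dotProduct, Finset.sum_mul]
    refine Finset.sum_congr rfl fun y _ => ?_
    rw [Fin.prod_univ_succ]
    simp [Fin.consEquiv, mul_assoc]

theorem tendsto_nonsing_inv {n ι : Type*} [Fintype n] [DecidableEq n] {l : Filter ι}
    {X : ι → Matrix n n ℝ} {A : Matrix n n ℝ} (h : Tendsto X l (𝓝 A)) (hA : IsUnit A) :
    Tendsto (fun i => (X i)⁻¹) l (𝓝 A⁻¹) := by
  have hd : A.det ≠ 0 := ((isUnit_iff_isUnit_det A).1 hA).ne_zero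
  simp only [inv_def, Ring.inverse_eq_inv']
  exact (((continuous_id.matrix_det.tendsto A).comp h).inv₀ hd).smul
    ((continuous_id.matrix_adjugate.tendsto A).comp h)

theorem abs_mulVec_le {n : Type*} [Fintype n] {N : Matrix n n ℝ}
    (hN : ∀ i j, 0 ≤ N i j) {x y : n → ℝ} (h : ∀ i, |x i| ≤ y i) (i : n) :
    |(N *ᵥ x) i| ≤ (N *ᵥ y) i := by
  refine (Finset.abs_sum_le_sum_abs _ _).trans (Finset.sum_le_sum fun j _ => ?_)
  rw [abs_mul, abs_of_nonneg (hN i j)]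
  exact mul_le_mul_of_nonneg_left (h j) (hN i j)

/-- The positive vector `-Q⁻¹ 𝟏` shows that an invertible Metzler matrix with nonpositive row sums
is stable. -/
theorem isStableMetzler_of_rowSum_nonpos {n : Type*} [Fintype n] [DecidableEq n]
    {Q : Matrix n n ℝ} (hoff : ∀ i j, i ≠ j → 0 ≤ Q i j) (hrow : ∀ i, (Q *ᵥ 1) i ≤ 0)
    (hQ : IsUnit Q) : IsStableMetzler Q (-(Q⁻¹ *ᵥ 1)) := by
  set v : n → ℝ := -(Q⁻¹ *ᵥ 1) with hv
  have hQv : Q *ᵥ v = -1 := by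
    rw [hv, mulVec_neg, mulVec_mulVec, mul_nonsing_inv _ ((isUnit_iff_isUnit_det Q).1 hQ),
      one_mulVec]
  refine ⟨hoff, fun i => ?_, fun i => by simp [hQv]⟩
  have : Nonempty n := ⟨i⟩
  obtain ⟨k, hk⟩ := Finite.exists_min v
  refine lt_of_lt_of_le ?_ (hk i)
  -- At a minimiser `k` with `v k ≤ 0`, the sign conditions on the entries and row sums of `Q` give
  -- `(Q v) k ≥ 0`, contradicting `Q v = -1`.
  by_contra! hk0
  have h1 : (Q *ᵥ v) k = ∑ j, Q k j * (v j - v k) + v k * (Q *ᵥ 1) k := by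
    simp only [mulVec, dotProduct, Pi.one_apply, mul_one, Finset.mul_sum]
    rw [← Finset.sum_add_distrib]
    exact Finset.sum_congr rfl fun j _ => by ring
  have h2 : 0 ≤ ∑ j, Q k j * (v j - v k) := Finset.sum_nonneg fun j _ => by
    by_cases hj : k = j
    · simp [hj]
    · exact mul_nonneg (hoff k j hj) (sub_nonneg.2 (hk j))
  have h3 := mul_nonneg_of_nonpos_of_nonpos hk0 (hrow k)
  rw [hQv] at h1
  simp only [Pi.neg_apply, Pi.one_apply] at h1
  linarith

end Matrix

/-! ### The discounted discrete skeleton and its limit -/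

namespace Kulkarni

section Generator

variable {E : Type u} [Fintype E] [DecidableEq E] (Q : Matrix E E ℝ)

/-- The matrix of the inclusion of the functions on `E` into the functions on `Option E` that
vanish at `none`. -/
def inclusion (E : Type u) [DecidableEq E] : Matrix (Option E) E ℝ :=
  Matrix.of fun x j => if x = some j then 1 else 0

@[simp]
theorem inclusion_mulVec_some (z : E → ℝ) (i : E) : (inclusion E *ᵥ z) (some i) = z i := by
  simp [inclusion, mulVec, dotProduct]

@[simp]
theorem inclusion_mulVec_none (z : E → ℝ) : (inclusion E *ᵥ z) none = 0 := by
  simp [inclusion, mulVec, dotProduct]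

@[simp]
theorem mul_inclusion_apply {m : Type*} (A : Matrix m (Option E) ℝ) (x : m) (j : E) :
    (A * inclusion E) x j = A x (some j) := by
  simp [inclusion, mul_apply]

@[simp]
theorem inclusion_mul_apply_some (B : Matrix E E ℝ) (i j : E) :
    (inclusion E * B) (some i) j = B i j := by
  simp [inclusion, mul_apply]

@[simp]
theorem inclusion_mul_apply_none (B : Matrix E E ℝ) (j : E) :
    (inclusion E * B) none j = 0 := by
  simp [inclusion, mul_apply]

theorem fullGenerator_mul_inclusion :
    fullGenerator Q * inclusion E = inclusion E * Q := by
  ext x j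
  cases x <;> simp [fullGenerator]

theorem fullGenerator_mulVec_one {E : Type u} [Fintype E] (Q : Matrix E E ℝ) :
    fullGenerator Q *ᵥ 1 = 0 := by
  ext x
  cases x <;> simp [fullGenerator, mulVec, dotProduct, Fintype.sum_option, exitRate]

theorem exp_smul_fullGenerator_mul_inclusion (t : ℝ) :
    NormedSpace.exp (t • fullGenerator Q) * inclusion E
      = inclusion E * NormedSpace.exp (t • Q) :=
  exp_mul_eq_of_intertwine (by
    rw [Matrix.smul_mul, fullGenerator_mul_inclusion, Matrix.mul_smul])

theorem exp_smul_fullGenerator_some_some (t : ℝ) (i j : E) :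
    NormedSpace.exp (t • fullGenerator Q) (some i) (some j) = NormedSpace.exp (t • Q) i j := by
  simpa using congrFun (congrFun (exp_smul_fullGenerator_mul_inclusion Q t) (some i)) j

theorem exp_smul_fullGenerator_none_some (t : ℝ) (j : E) :
    NormedSpace.exp (t • fullGenerator Q) none (some j) = 0 := by
  simpa using congrFun (congrFun (exp_smul_fullGenerator_mul_inclusion Q t) none) j

/-- Zero row sums say that the column `1` intertwines the generator with the `1 × 1` zero matrix. -/
theorem exp_smul_fullGenerator_mulVec_one (t : ℝ) :
    NormedSpace.exp (t • fullGenerator Q) *ᵥ 1 = 1 := by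
  have h : (t • fullGenerator Q) * replicateCol Unit (1 : Option E → ℝ)
      = replicateCol Unit (1 : Option E → ℝ) * (0 : Matrix Unit Unit ℝ) := by
    rw [Matrix.smul_mul, ← replicateCol_mulVec, fullGenerator_mulVec_one]
    ext; simp
  have h2 := exp_mul_eq_of_intertwine h
  rw [NormedSpace.exp_zero, Matrix.mul_one, ← replicateCol_mulVec] at h2
  exact replicateCol_injective h2

/-- The transition matrix of one step of length `h`, discounted at the rates `k`. -/
noncomputable def discountedStep (k : E → ℝ) (h : ℝ) : Matrix E E ℝ :=
  NormedSpace.exp (h • Q) * diagonal fun i => Real.exp (-(h * k i))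

/-- The transition matrix on the full state space of one step of length `h`, discounted at the
rates `k`. -/
noncomputable def fullDiscountedStep (k : E → ℝ) (h : ℝ) : Matrix (Option E) (Option E) ℝ :=
  NormedSpace.exp (h • fullGenerator Q) *
    diagonal fun x : Option E => Real.exp (-(h * x.elim 0 k))

theorem fullDiscountedStep_mul_inclusion (k : E → ℝ) (h : ℝ) :
    fullDiscountedStep Q k h * inclusion E = inclusion E * discountedStep Q k h := by
  have e : (diagonal fun x : Option E => Real.exp (-(h * x.elim 0 k))) * inclusion E
      = inclusion E * diagonal fun i => Real.exp (-(h * k i)) := by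
    ext x j
    cases x with
    | none => simp [inclusion]
    | some i => by_cases hij : i = j <;> simp [inclusion, hij]
  rw [fullDiscountedStep, discountedStep, Matrix.mul_assoc, e, ← Matrix.mul_assoc,
    exp_smul_fullGenerator_mul_inclusion, Matrix.mul_assoc]

theorem fullDiscountedStep_mulVec_single (k : E → ℝ) (h : ℝ) :
    fullDiscountedStep Q k h *ᵥ Pi.single none 1
      = Pi.single none 1 + inclusion E *ᵥ (1 - NormedSpace.exp (h • Q) *ᵥ 1) := by
  have e1 : (Pi.single none 1 : Option E → ℝ) = 1 - inclusion E *ᵥ 1 := by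
    ext x; cases x <;> simp
  have e2 : (diagonal fun x : Option E => Real.exp (-(h * x.elim 0 k))) *ᵥ Pi.single none 1
      = Pi.single none 1 := by
    ext x; rw [mulVec_diagonal]; cases x <;> simp
  rw [fullDiscountedStep, ← mulVec_mulVec, e2, e1, mulVec_sub,
    exp_smul_fullGenerator_mulVec_one, mulVec_mulVec, exp_smul_fullGenerator_mul_inclusion,
    mulVec_sub, mulVec_mulVec]
  abel

theorem fullInitial_dotProduct_inclusion (α z : E → ℝ) :
    fullInitial α ⬝ᵥ (inclusion E *ᵥ z) = α ⬝ᵥ z := by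
  simp [dotProduct, Fintype.sum_option, fullInitial]

/-- The hypothesis on `z` says exactly that `w`, equal to `1` at `none` and to `z` on `E`, is fixed
by the full discounted step. Writing `1 = w + (1 - z)`, with the second term supported on `E`,
separates the stationary part from a remainder governed by the transient block alone. -/
theorem fullInitial_dotProduct_fullDiscountedStep_pow {k : E → ℝ} {h : ℝ} {z : E → ℝ}
    (hz : z - discountedStep Q k h *ᵥ z = 1 - NormedSpace.exp (h • Q) *ᵥ 1) (α : E → ℝ) (m : ℕ) :
    fullInitial α ⬝ᵥ (fullDiscountedStep Q k h ^ m *ᵥ 1)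
      = (1 - ∑ i, α i) + α ⬝ᵥ z + α ⬝ᵥ (discountedStep Q k h ^ m *ᵥ (1 - z)) := by
  set w : Option E → ℝ := Pi.single none 1 + inclusion E *ᵥ z with hw
  have hfix : fullDiscountedStep Q k h *ᵥ w = w := by
    rw [hw, mulVec_add, fullDiscountedStep_mulVec_single, ← hz, mulVec_mulVec,
      fullDiscountedStep_mul_inclusion, mulVec_sub, mulVec_mulVec]
    abel
  have hpow : fullDiscountedStep Q k h ^ m *ᵥ w = w := by
    induction m with
    | zero => simp
    | succ m ih => rw [pow_succ, ← mulVec_mulVec, hfix, ih]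
  have e1 : (1 : Option E → ℝ) = w + inclusion E *ᵥ (1 - z) := by
    ext x; cases x <;> simp [hw]
  rw [e1, mulVec_add, hpow, mulVec_mulVec,
    pow_mulVec_eq_of_intertwine (fullDiscountedStep_mul_inclusion Q k h), ← mulVec_mulVec,
    dotProduct_add, fullInitial_dotProduct_inclusion, hw, dotProduct_add,
    fullInitial_dotProduct_inclusion]
  simp [fullInitial]

theorem discountedStep_nonneg {v : E → ℝ} (hQ : IsStableMetzler Q v) (k : E → ℝ)
    {h : ℝ} (hh : 0 ≤ h) (i j : E) : 0 ≤ discountedStep Q k h i j := by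
  rw [discountedStep, mul_diagonal]
  exact mul_nonneg (hQ.exp_smul_apply_nonneg hh i j) (Real.exp_pos _).le

/-- Discounting at nonnegative rates only decreases the undiscounted bound; the rate `δ` is uniform
in `h`. -/
theorem exists_discountedStep_mulVec_le {v : E → ℝ} (hQ : IsStableMetzler Q v) {k : E → ℝ}
    (hk : ∀ i, 0 ≤ k i) : ∃ δ > 0, ∀ h : ℝ, 0 ≤ h → ∀ i,
      (discountedStep Q k h *ᵥ v) i ≤ Real.exp (-(δ * h)) * v i := by
  obtain ⟨δ, hδ, hb⟩ := hQ.exists_exp_smul_mulVec_le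
  refine ⟨δ, hδ, fun h hh i => le_trans ?_ (hb h hh i)⟩
  rw [discountedStep, ← mulVec_mulVec]
  refine mulVec_mono_of_nonneg (hQ.exp_smul_apply_nonneg hh) (fun j => ?_) i
  rw [mulVec_diagonal]
  exact mul_le_of_le_one_left (hQ.pos j).le
    (Real.exp_le_one_iff.2 (neg_nonpos.2 (mul_nonneg hh (hk j))))

theorem tendsto_inv_natCast_add_one :
    Tendsto (fun n : ℕ => ((n : ℝ) + 1)⁻¹) atTop (𝓝[≠] 0) :=
  tendsto_nhdsWithin_iff.2 ⟨by simpa using tendsto_one_div_add_atTop_nhds_zero_nat (𝕜 := ℝ),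
    .of_forall fun n => by simp; positivity⟩

theorem tendsto_slope_discountedStep (k : E → ℝ) :
    Tendsto (fun h : ℝ => h⁻¹ • (1 - discountedStep Q k h)) (𝓝[≠] 0) (𝓝 (diagonal k - Q)) := by
  refine tendsto_pi_nhds.2 fun i => tendsto_pi_nhds.2 fun j => ?_
  have h1 := hasDerivAt_exp_smul_apply Q 0 i j
  have h2 : HasDerivAt (fun h : ℝ => Real.exp (-(h * k j))) (-k j) 0 := by
    have := (((hasDerivAt_id (0 : ℝ)).mul_const (k j)).neg).exp
    simpa using this
  have h3 := (h1.mul h2).neg.tendsto_slope_zero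
  have e : ∀ h : ℝ, (h⁻¹ • (1 - discountedStep Q k h)) i j
      = h⁻¹ * (-(NormedSpace.exp (h • Q) i j * Real.exp (-(h * k j))) - -(1 : Matrix E E ℝ) i j) := by
    intro h
    rw [Matrix.smul_apply, Matrix.sub_apply, discountedStep, mul_diagonal, smul_eq_mul]
    ring
  simp only [e]
  convert h3 using 2
  · simp
  · by_cases hij : i = j <;> simp [hij]
    ring

theorem tendsto_slope_exp_mulVec_one :
    Tendsto (fun h : ℝ => h⁻¹ • (1 - NormedSpace.exp (h • Q) *ᵥ 1)) (𝓝[≠] 0)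
      (𝓝 (exitRate Q)) := by
  refine tendsto_pi_nhds.2 fun i => ?_
  have h3 := (hasDerivAt_dotProduct_exp_smul_mulVec Q (Pi.single i 1) 1 0).neg.tendsto_slope_zero
  convert h3 using 2
  · simp
    exact Or.inl (by ring)
  · simp [exitRate]

theorem tendsto_fullInitial_dotProduct_fullDiscountedStep_pow {v : E → ℝ}
    (hQ : IsStableMetzler Q v) {k : E → ℝ} (hk : ∀ i, 0 ≤ k i) (α : E → ℝ) :
    Tendsto (fun n : ℕ => fullInitial α ⬝ᵥ
        (fullDiscountedStep Q k ((n : ℝ) + 1)⁻¹ ^ ((n + 1) ^ 2) *ᵥ 1)) atTop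
      (𝓝 ((1 - ∑ i, α i) + α ⬝ᵥ ((diagonal k - Q)⁻¹ *ᵥ exitRate Q))) := by
  have hU : IsUnit (diagonal k - Q) := by
    simpa using (hQ.sub_diagonal hk).isUnit_neg
  let h : ℕ → ℝ := fun n => ((n : ℝ) + 1)⁻¹
  have hpos : ∀ n, 0 < h n := fun n => by positivity
  -- Dividing the fixed-vector equation by `h` gives `X z = y`, where `X` tends to the invertible
  -- `diagonal k - Q` and `y` to the exit vector.
  let X : ℕ → Matrix E E ℝ := fun n => (h n)⁻¹ • (1 - discountedStep Q k (h n))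
  let y : ℕ → E → ℝ := fun n => (h n)⁻¹ • (1 - NormedSpace.exp (h n • Q) *ᵥ 1)
  have hX : Tendsto X atTop (𝓝 (diagonal k - Q)) :=
    (tendsto_slope_discountedStep Q k).comp tendsto_inv_natCast_add_one
  have hy : Tendsto y atTop (𝓝 (exitRate Q)) :=
    (tendsto_slope_exp_mulVec_one Q).comp tendsto_inv_natCast_add_one
  let z : ℕ → E → ℝ := fun n => (X n)⁻¹ *ᵥ y n
  set ζ := (diagonal k - Q)⁻¹ *ᵥ exitRate Q with hζ
  have hXi := tendsto_nonsing_inv hX hU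
  have hz : ∀ i, Tendsto (fun n => z n i) atTop (𝓝 (ζ i)) := fun i =>
    tendsto_finsetSum _ fun j _ =>
      ((tendsto_pi_nhds.1 ((tendsto_pi_nhds.1 hXi) i)) j).mul (tendsto_pi_nhds.1 hy j)
  have hdet : ∀ᶠ n in atTop, IsUnit (X n).det := by
    have h1 := ((continuous_id.matrix_det.tendsto _).comp hX).eventually_ne
      ((isUnit_iff_isUnit_det _).1 hU).ne_zero
    filter_upwards [h1] with n hn using isUnit_iff_ne_zero.2 hn
  -- Since `1 - z n` converges and `v` is positive, a multiple of `v` eventually dominates it, so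
  -- the geometric decay along `v` applies.
  obtain ⟨C, hC⟩ : ∃ C, ∀ᶠ n in atTop, ∀ i, |(1 - z n) i| ≤ C * v i := by
    refine ⟨∑ i, (|1 - ζ i| + 1) / v i, eventually_all.2 fun i => ?_⟩
    have h1 : Tendsto (fun n => |1 - z n i|) atTop (𝓝 |1 - ζ i|) :=
      (tendsto_const_nhds.sub (hz i)).abs
    filter_upwards [h1.eventually_le_const (lt_add_one _)] with n hn
    have h2 : (|1 - ζ i| + 1) / v i ≤ ∑ i, (|1 - ζ i| + 1) / v i :=
      Finset.single_le_sum (f := fun i => (|1 - ζ i| + 1) / v i)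
        (fun i _ => div_nonneg (by positivity) (hQ.pos i).le) (Finset.mem_univ i)
    exact hn.trans ((div_le_iff₀ (hQ.pos i)).1 h2)
  obtain ⟨δ, hδ, hdecay⟩ := exists_discountedStep_mulVec_le Q hQ hk
  have hrem : ∀ i, Tendsto (fun n => (discountedStep Q k (h n) ^ ((n + 1) ^ 2) *ᵥ (1 - z n)) i)
      atTop (𝓝 0) := by
    intro i
    have h0 : Tendsto (fun n : ℕ => C * (Real.exp (-(δ * ((n : ℝ) + 1))) * v i)) atTop (𝓝 0) := by
      have h1 : Tendsto (fun n : ℕ => -(δ * ((n : ℝ) + 1))) atTop atBot :=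
        tendsto_neg_atTop_atBot.comp ((tendsto_atTop_add_const_right _ 1
          tendsto_natCast_atTop_atTop).const_mul_atTop hδ)
      simpa using ((Real.tendsto_exp_atBot.comp h1).mul_const (v i)).const_mul C
    refine squeeze_zero_norm' ?_ h0
    filter_upwards [hC] with n hn
    have hnn := discountedStep_nonneg Q hQ k (hpos n).le
    have hp := fun i j => Matrix.pow_apply_nonneg hnn ((n + 1) ^ 2) i j
    have hC' : ∀ i, |(1 - z n) i| ≤ (C • v) i := hn
    refine (abs_mulVec_le hp hC' i).trans ?_
    rw [mulVec_smul, Pi.smul_apply, smul_eq_mul]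
    have hC0 : 0 ≤ C := by
      have := (abs_nonneg _).trans (hn i)
      exact nonneg_of_mul_nonneg_left this (hQ.pos i)
    refine mul_le_mul_of_nonneg_left ?_ hC0
    refine (pow_mulVec_le hnn (Real.exp_pos _).le (hdecay _ (hpos n).le) _ i).trans_eq ?_
    -- There are `(n + 1)²` steps of length `1 / (n + 1)`: the mesh shrinks while the horizon `n +
    -- 1` grows.
    rw [← Real.exp_nat_mul]
    congr 2
    have : h n * ((n : ℝ) + 1) = 1 := inv_mul_cancel₀ (by positivity)
    push_cast
    linear_combination (-δ * ((n : ℝ) + 1)) * this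
  have hmain : Tendsto (fun n => (1 - ∑ i, α i) + α ⬝ᵥ z n
      + α ⬝ᵥ (discountedStep Q k (h n) ^ ((n + 1) ^ 2) *ᵥ (1 - z n))) atTop
      (𝓝 ((1 - ∑ i, α i) + α ⬝ᵥ ζ)) := by
    have h1 : Tendsto (fun n => α ⬝ᵥ z n) atTop (𝓝 (α ⬝ᵥ ζ)) :=
      tendsto_finsetSum _ fun i _ => (hz i).const_mul _
    have h2 : Tendsto (fun n => α ⬝ᵥ (discountedStep Q k (h n) ^ ((n + 1) ^ 2) *ᵥ (1 - z n)))
        atTop (𝓝 0) := by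
      have : Tendsto (fun n => α ⬝ᵥ (discountedStep Q k (h n) ^ ((n + 1) ^ 2) *ᵥ (1 - z n)))
        atTop (𝓝 (∑ i, α i * 0)) := tendsto_finsetSum _ fun i _ => (hrem i).const_mul _
      simpa using this
    simpa using (tendsto_const_nhds.add h1).add h2
  refine hmain.congr' ?_
  filter_upwards [hdet] with n hn
  refine (fullInitial_dotProduct_fullDiscountedStep_pow Q ?_ α _).symm
  have h1 : X n *ᵥ z n = y n := by
    rw [mulVec_mulVec, mul_nonsing_inv _ hn, one_mulVec]
  simp only [X, y, smul_mulVec, sub_mulVec, one_mulVec] at h1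
  exact smul_right_injective _ (inv_ne_zero (hpos n).ne') h1

end Generator

end Kulkarni

/-! ### Absorption and the transform of the reward -/

namespace Kulkarni

namespace IsMarkovProcess

section General

variable {S : Type u} [Fintype S] [DecidableEq S] {G : Matrix S S ℝ} {init : S → ℝ}
  {Ω : Type v} [MeasurableSpace Ω] {P : Measure Ω} {J : ℝ≥0 → Ω → S}

theorem measurableSet_path (h : IsMarkovProcess G init P J) {ι : Type*} [Finite ι]
    (t : ι → ℝ≥0) (x : ι → S) : MeasurableSet {ω | ∀ i, J (t i) ω = x i} := by
  rw [Set.ofPred_forall]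
  have := Fintype.ofFinite ι
  exact MeasurableSet.iInter fun i => h.measurableSet_eq _ _

theorem measurable_comp (h : IsMarkovProcess G init P J) (t : ℝ≥0) (f : S → ℝ) :
    Measurable fun ω => f (J t ω) := by
  let _ : MeasurableSpace S := ⊤
  have : Measurable (J t) := measurable_to_countable' fun x => h.measurableSet_eq t x
  exact (measurable_from_top (f := f)).comp this

theorem integral_path [IsFiniteMeasure P] (h : IsMarkovProcess G init P J) {m : ℕ}
    (t : Fin (m + 1) → ℝ≥0) (F : (Fin (m + 1) → S) → ℝ) :
    ∫ ω, F (fun i => J (t i) ω) ∂P = ∑ x, P.real {ω | ∀ i, J (t i) ω = x i} * F x := by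
  have e : ∀ ω, F (fun i => J (t i) ω)
      = ∑ x, {ω | ∀ i, J (t i) ω = x i}.indicator (fun _ => F x) ω := by
    intro ω
    rw [Finset.sum_eq_single fun i => J (t i) ω]
    · simp
    · intro x _ hx
      refine Set.indicator_of_notMem (fun hm => hx ?_) _
      exact (funext hm).symm
    · simp
  simp only [e]
  rw [integral_finsetSum _ fun x _ =>
    (integrable_const (F x)).indicator (h.measurableSet_path t x)]
  refine Finset.sum_congr rfl fun x _ => ?_
  rw [integral_indicator_const _ (h.measurableSet_path t x), smul_eq_mul]

/-- The distributions `fdd` start at time `0`, so the initial state is added and summed over; the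
union bound suffices for the later use. -/
theorem measureReal_eq_le [IsFiniteMeasure P] (h : IsMarkovProcess G init P J) (t : ℝ≥0) (y : S) :
    P.real {ω | J t ω = y} ≤ ∑ x, init x * NormedSpace.exp ((t : ℝ) • G) x y := by
  have hsub : {ω | J t ω = y} ⊆ ⋃ x, {ω | ∀ i : Fin 2, J (![0, t] i) ω = ![x, y] i} := by
    intro ω hω
    exact Set.mem_iUnion.2 ⟨J 0 ω, fun i => by fin_cases i; exacts [rfl, hω]⟩
  refine (measureReal_mono hsub).trans ((measureReal_iUnion_fintype_le _).trans_eq ?_)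
  refine Finset.sum_congr rfl fun x _ => ?_
  rw [h.fdd 1 ![0, t] ![x, y] (by simp [Fin.monotone_iff_le_succ]) rfl]
  simp

/-- The discount of each step is attached to the state reached, so path probability times discount
is a product of entries of a single matrix. -/
theorem integral_exp_neg_sum [IsFiniteMeasure P] (h : IsMarkovProcess G init P J) (k : S → ℝ)
    (n m : ℕ) :
    ∫ ω, Real.exp (-(((n : ℝ) + 1)⁻¹ * ∑ i ∈ Finset.range m,
        k (J (((i : ℝ≥0) + 1) / ((n : ℝ≥0) + 1)) ω))) ∂P
      = init ⬝ᵥ ((NormedSpace.exp (((n : ℝ) + 1)⁻¹ • G) *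
          diagonal fun x => Real.exp (-(((n : ℝ) + 1)⁻¹ * k x))) ^ m *ᵥ 1) := by
  rw [← sum_prod_path_eq]
  let t : Fin (m + 1) → ℝ≥0 := fun i => ((i : ℕ) : ℝ≥0) / ((n : ℝ≥0) + 1)
  have ht : Monotone t := fun i j hij => by
    have : ((i : ℕ) : ℝ≥0) ≤ (j : ℕ) := Nat.cast_le.2 hij
    exact div_le_div_of_nonneg_right this (by positivity)
  have ht0 : t 0 = 0 := by simp [t]
  have hdiff : ∀ i : Fin m, (t i.succ : ℝ) - (t i.castSucc : ℝ) = ((n : ℝ) + 1)⁻¹ := fun i => by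
    simp only [t, Fin.val_succ, Fin.val_castSucc, NNReal.coe_div, NNReal.coe_natCast,
      NNReal.coe_add, NNReal.coe_one, Nat.cast_add, Nat.cast_one]
    ring
  have e := h.integral_path t fun x =>
    Real.exp (-(((n : ℝ) + 1)⁻¹ * ∑ i : Fin m, k (x i.succ)))
  have e2 : ∀ ω, ∑ i : Fin m, k (J (t i.succ) ω) = ∑ i ∈ Finset.range m,
      k (J (((i : ℝ≥0) + 1) / ((n : ℝ≥0) + 1)) ω) := fun ω => by
    rw [Finset.sum_range]
    simp [t]
  simp only [e2] at e
  rw [e]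
  refine Finset.sum_congr rfl fun x _ => ?_
  rw [h.fdd m t x ht ht0]
  simp only [hdiff, mul_diagonal, Finset.prod_mul_distrib]
  rw [← Real.exp_sum, Finset.mul_sum, Finset.sum_neg_distrib, mul_assoc]

end General

section Absorption

variable {E : Type u} [Fintype E] [DecidableEq E] {Q : Matrix E E ℝ} {α : E → ℝ}
  {Ω : Type v} [MeasurableSpace Ω] {P : Measure Ω} [IsFiniteMeasure P]
  {J : ℝ≥0 → Ω → Option E}

theorem ae_none_of_none (h : IsMarkovProcess (fullGenerator Q) (fullInitial α) P J)
    {a b : ℝ≥0} (hab : a ≤ b) : ∀ᵐ ω ∂P, J a ω = none → J b ω = none := by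
  have hpath : ∀ x y, ∀ᵐ ω ∂P,
      ¬ ∀ i : Fin 3, J (![0, a, b] i) ω = ![x, none, some y] i := by
    intro x y
    have h0 : P.real {ω | ∀ i : Fin 3, J (![0, a, b] i) ω = ![x, none, some y] i} = 0 := by
      rw [h.fdd 2 ![0, a, b] ![x, none, some y]
        (by simp [Fin.monotone_iff_le_succ, Fin.forall_fin_succ, hab]) rfl]
      simp only [Fin.prod_univ_two]
      have := exp_smul_fullGenerator_none_some Q ((b : ℝ) - a) y
      simp [this]
    exact measure_eq_zero_iff_ae_notMem.1 ((measureReal_eq_zero_iff (measure_ne_top _ _)).1 h0)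
  filter_upwards [ae_all_iff.2 fun x => ae_all_iff.2 (hpath x)] with ω hω ha
  cases hb : J b ω with
  | none => rfl
  | some y =>
    exact absurd (fun i => by fin_cases i; exacts [rfl, ha, hb]) (hω (J 0 ω) y)

/-- Almost surely the property holds on a countable dense set of times. Right-continuity transfers
it to all times: `a` and `b` are replaced by dense times slightly to their right, the first still
below `b`. -/
theorem ae_absorbing (h : IsMarkovProcess (fullGenerator Q) (fullInitial α) P J) :
    ∀ᵐ ω ∂P, ∀ a b : ℝ≥0, a ≤ b → J a ω = none → J b ω = none := by
  obtain ⟨D, hDc, hD⟩ := TopologicalSpace.exists_countable_dense ℝ≥0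
  have := hDc.to_subtype
  have hall : ∀ᵐ ω ∂P, ∀ p q : D, (p : ℝ≥0) ≤ q → J p ω = none → J q ω = none :=
    ae_all_iff.2 fun p => ae_all_iff.2 fun q => by
      by_cases hpq : (p : ℝ≥0) ≤ q
      · simpa [hpq] using h.ae_none_of_none hpq
      · simp [hpq]
  filter_upwards [hall] with ω hω a b hab ha
  rcases hab.eq_or_lt with rfl | hab
  · exact ha
  have hnear : ∀ s c : ℝ≥0, s < c → ∃ p ∈ D, s < p ∧ p < c ∧ J p ω = J s ω := by
    intro s c hsc
    have h1 : ∀ᶠ u in 𝓝[>] s, J u ω = J s ω :=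
      (h.right_continuous ω s).filter_mono (nhdsWithin_mono _ Set.Ioi_subset_Ici_self)
    obtain ⟨d, hd, hsub⟩ := (mem_nhdsGT_iff_exists_Ioo_subset' hsc).1 h1
    obtain ⟨p, hp, h2, h3⟩ := hD.exists_between (lt_min hd hsc)
    exact ⟨p, hp, h2, h3.trans_le (min_le_right _ _), hsub ⟨h2, h3.trans_le (min_le_left _ _)⟩⟩
  obtain ⟨p, hp, hap, hpb, hJp⟩ := hnear a b hab
  obtain ⟨q, hq, hbq, -, hJq⟩ := hnear b (b + 1) (lt_add_one b)
  rw [← hJq]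
  exact hω ⟨p, hp⟩ ⟨q, hq⟩ (hpb.trans hbq).le (hJp.trans ha)

/-- Not being absorbed at any integer time implies being in `E` at time `n`, which has probability
at most the total mass of `α e^{nQ}`, tending to `0`. -/
theorem ae_exists_none (h : IsMarkovProcess (fullGenerator Q) (fullInitial α) P J) {v : E → ℝ}
    (hQ : IsStableMetzler Q v) : ∀ᵐ ω ∂P, ∃ N : ℕ, J N ω = none := by
  have hle : ∀ n : ℕ, P.real {ω | ¬ ∃ N : ℕ, J N ω = none}
      ≤ ∑ j, ∑ i, α i * NormedSpace.exp ((n : ℝ) • Q) i j := by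
    intro n
    have hsub : {ω | ¬ ∃ N : ℕ, J N ω = none} ⊆ ⋃ j, {ω | J n ω = some j} := by
      intro ω hω
      obtain ⟨j, hj⟩ := Option.ne_none_iff_exists'.1 fun hn => hω ⟨n, hn⟩
      exact Set.mem_iUnion.2 ⟨j, hj⟩
    refine (measureReal_mono hsub).trans ((measureReal_iUnion_fintype_le _).trans ?_)
    refine Finset.sum_le_sum fun j _ => (h.measureReal_eq_le _ _).trans_eq ?_
    rw [Fintype.sum_option]
    simp only [NNReal.coe_natCast, exp_smul_fullGenerator_none_some,
      exp_smul_fullGenerator_some_some, fullInitial]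
    simp
  have hlim : Tendsto (fun n : ℕ => ∑ j, ∑ i, α i * NormedSpace.exp ((n : ℝ) • Q) i j) atTop
      (𝓝 0) := by
    obtain ⟨δ, hδ, C, hC⟩ := hQ.exists_abs_exp_smul_apply_le
    have h0 : Tendsto (fun n : ℕ => C * Real.exp (-δ * n)) atTop (𝓝 0) := by
      have := (Real.tendsto_exp_atBot.comp (tendsto_natCast_atTop_atTop.const_mul_atTop_of_neg
        (neg_neg_of_pos hδ))).const_mul C
      simpa using this
    have h1 : ∀ i j, Tendsto (fun n : ℕ => NormedSpace.exp ((n : ℝ) • Q) i j) atTop (𝓝 0) :=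
      fun i j => squeeze_zero_norm (fun n => hC n (Nat.cast_nonneg n) i j) h0
    simpa using tendsto_finsetSum Finset.univ fun j _ =>
      tendsto_finsetSum Finset.univ fun i _ => (h1 i j).const_mul (α i)
  have hz := le_antisymm (ge_of_tendsto' hlim hle) measureReal_nonneg
  exact (measureReal_eq_zero_iff (by simp)).1 hz

theorem ae_tendsto_riemannSum (h : IsMarkovProcess (fullGenerator Q) (fullInitial α) P J)
    {v : E → ℝ} (hQ : IsStableMetzler Q v) :
    ∀ᵐ ω ∂P, ∀ r : E → ℝ,
      Tendsto (fun n : ℕ => ((n : ℝ) + 1)⁻¹ * ∑ i ∈ Finset.range ((n + 1) ^ 2),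
        (J (((i : ℝ≥0) + 1) / ((n : ℝ≥0) + 1)) ω).elim 0 r) atTop
      (𝓝 (accumulatedReward r J ω)) := by
  filter_upwards [h.ae_absorbing, h.ae_exists_none hQ] with ω habs hN r
  obtain ⟨N, hN⟩ := hN
  exact tendsto_riemannSum_accumulatedReward (h.right_continuous ω) habs hN r

/-- Linearity is read off the Riemann sums, all three of which converge on one almost sure event;
this avoids integrability of individual paths. -/
theorem ae_accumulatedReward_add_smul
    (h : IsMarkovProcess (fullGenerator Q) (fullInitial α) P J)
    {v : E → ℝ} (hQ : IsStableMetzler Q v) (r r' : E → ℝ) (a b : ℝ) :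
    ∀ᵐ ω ∂P, accumulatedReward (a • r + b • r') J ω
      = a * accumulatedReward r J ω + b * accumulatedReward r' J ω := by
  filter_upwards [h.ae_tendsto_riemannSum hQ] with ω hω
  refine tendsto_nhds_unique (hω _) ((((hω r).const_mul a).add ((hω r').const_mul b)).congr
    fun n => ?_)
  rw [mul_left_comm a, mul_left_comm b, ← mul_add, Finset.mul_sum, Finset.mul_sum,
    ← Finset.sum_add_distrib]
  congr 1
  refine Finset.sum_congr rfl fun i _ => ?_
  cases J (((i : ℝ≥0) + 1) / ((n : ℝ≥0) + 1)) ω <;> simp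

/-- The Laplace transform of the reward accumulated until absorption. -/
theorem integral_exp_neg_accumulatedReward
    (h : IsMarkovProcess (fullGenerator Q) (fullInitial α) P J)
    {v : E → ℝ} (hQ : IsStableMetzler Q v) {k : E → ℝ} (hk : ∀ i, 0 ≤ k i) :
    ∫ ω, Real.exp (-accumulatedReward k J ω) ∂P
      = (1 - ∑ i, α i) + α ⬝ᵥ ((diagonal k - Q)⁻¹ *ᵥ exitRate Q) := by
  have hk' : ∀ x : Option E, 0 ≤ x.elim 0 k := fun x => by
    cases x with
    | none => exact le_rfl
    | some i => exact hk i
  have hlim := tendsto_integral_of_dominated_convergence (μ := P)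
    (F := fun (n : ℕ) ω => Real.exp (-(((n : ℝ) + 1)⁻¹ * ∑ i ∈ Finset.range ((n + 1) ^ 2),
        (J (((i : ℝ≥0) + 1) / ((n : ℝ≥0) + 1)) ω).elim 0 k)))
    (f := fun ω => Real.exp (-accumulatedReward k J ω)) (fun _ => 1)
    (fun n => (Real.measurable_exp.comp ((Finset.measurable_fun_sum _ fun i _ =>
      h.measurable_comp _ fun x => x.elim 0 k).const_mul _).neg).aestronglyMeasurable)
    (integrable_const 1)
    (fun n => .of_forall fun ω => by
      rw [Real.norm_eq_abs, abs_of_pos (Real.exp_pos _)]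
      exact Real.exp_le_one_iff.2 (neg_nonpos.2 (mul_nonneg (by positivity)
        (Finset.sum_nonneg fun i _ => hk' _))))
    (by
      filter_upwards [h.ae_tendsto_riemannSum hQ] with ω hω
      exact (Real.continuous_exp.tendsto _).comp (hω k).neg)
  refine tendsto_nhds_unique hlim ?_
  simp only [h.integral_exp_neg_sum fun x => x.elim 0 k]
  exact tendsto_fullInitial_dotProduct_fullDiscountedStep_pow Q hQ hk α

end Absorption

end IsMarkovProcess

end Kulkarni

/-! ### Submatrices, Schur complements, Laplace transforms -/

namespace Matrix.IsStableMetzler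

/-- The terms dropped from row `f i` are off-diagonal, hence nonnegative, so the restricted row sum
against `v` is no larger. -/
theorem submatrix {m n : Type*} [Fintype m] [Fintype n] {A : Matrix n n ℝ} {v : n → ℝ}
    (h : IsStableMetzler A v) {f : m → n} (hf : Function.Injective f) :
    IsStableMetzler (A.submatrix f f) (v ∘ f) where
  offDiag_nonneg i j hij := h.offDiag_nonneg _ _ (hf.ne hij)
  pos i := h.pos _
  mulVec_neg i := by
    classical
    refine lt_of_le_of_lt ?_ (h.mulVec_neg (f i))
    have e : (A.submatrix f f *ᵥ (v ∘ f)) i = ∑ x ∈ Finset.univ.image f, A (f i) x * v x := by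
      rw [Finset.sum_image fun _ _ _ _ hxy => hf hxy]
      rfl
    rw [e]
    refine Finset.sum_le_sum_of_subset_of_nonneg (Finset.subset_univ _) fun x _ hx => ?_
    refine mul_nonneg (h.offDiag_nonneg _ _ ?_) (h.pos x).le
    rintro rfl
    exact hx (Finset.mem_image_of_mem f (Finset.mem_univ i))

/-- The Schur complement of a stable Metzler block matrix is a stable Metzler matrix. -/
theorem schurComplement {m n : Type*} [Fintype m] [DecidableEq m] [Fintype n]
    {A : Matrix m m ℝ} {B : Matrix m n ℝ} {C : Matrix n m ℝ} {D : Matrix n n ℝ} {v : m → ℝ}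
    {w : n → ℝ} (hA : IsStableMetzler A v) (hB : ∀ i j, 0 ≤ B i j) (hC : ∀ i j, 0 ≤ C i j)
    (hD : ∀ i j, i ≠ j → 0 ≤ D i j) (hw : ∀ i, 0 < w i) (h1 : ∀ i, (A *ᵥ v + B *ᵥ w) i ≤ 0)
    (h2 : ∀ i, (C *ᵥ v + D *ᵥ w) i < 0) :
    IsStableMetzler (D - C * A⁻¹ * B) w := by
  have hneg : A⁻¹ = -(-A)⁻¹ := by
    refine inv_eq_left_inv ?_
    rw [neg_mul, ← mul_neg, nonsing_inv_mul _ ((isUnit_iff_isUnit_det _).1 hA.isUnit_neg)]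
  have e : D - C * A⁻¹ * B = D + C * ((-A)⁻¹ * B) := by
    rw [hneg, Matrix.mul_neg, Matrix.neg_mul, sub_neg_eq_add, Matrix.mul_assoc]
  rw [e]
  have hinvB : ∀ i j, 0 ≤ ((-A)⁻¹ * B) i j := fun i j =>
    Finset.sum_nonneg fun l _ => mul_nonneg (hA.neg_inv_apply_nonneg i l) (hB l j)
  refine ⟨fun i j hij => ?_, hw, fun i => ?_⟩
  · exact add_nonneg (hD i j hij)
      (Finset.sum_nonneg fun l _ => mul_nonneg (hC i l) (hinvB l j))
  -- `A (v - (-A)⁻¹ B w) = A v + B w ≤ 0`, so the minimum principle gives `(-A)⁻¹ B w ≤ v`; the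
  -- Schur complement applied to `w` is then at most `C v + D w < 0`.
  · have hv : ∀ j, (((-A)⁻¹ * B) *ᵥ w) j ≤ v j := fun j => by
      have := hA.nonneg_of_mulVec_nonpos (x := v - ((-A)⁻¹ * B) *ᵥ w) (fun l => by
        have hAA : A *ᵥ (((-A)⁻¹ * B) *ᵥ w) = -(B *ᵥ w) := by
          rw [mulVec_mulVec, ← Matrix.mul_assoc, ← neg_neg (A * (-A)⁻¹), ← Matrix.neg_mul A,
            mul_nonsing_inv _ ((isUnit_iff_isUnit_det _).1 hA.isUnit_neg), Matrix.neg_mul,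
            Matrix.one_mul, neg_mulVec]
        rw [mulVec_sub, hAA, sub_neg_eq_add]
        exact h1 l) j
      simpa using this
    have h3 := mulVec_mono_of_nonneg hC hv i
    have h4 := h2 i
    rw [add_mulVec, ← mulVec_mulVec, Pi.add_apply]
    rw [Pi.add_apply] at h4
    linarith

/-- The Laplace transform of the matrix-exponential function `y ↦ a e^{Ay} b`. -/
theorem integral_exp_neg_mul_dotProduct_exp {n : Type*} [Fintype n] [DecidableEq n]
    {A : Matrix n n ℝ} {v : n → ℝ} (h : IsStableMetzler A v) (a b : n → ℝ) {x : ℝ} (hx : 0 ≤ x) :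
    ∫ t in Set.Ioi (0 : ℝ), (a ⬝ᵥ (NormedSpace.exp (t • A) *ᵥ b)) * Real.exp (-(x * t))
      = a ⬝ᵥ ((x • (1 : Matrix n n ℝ) - A)⁻¹ *ᵥ b) := by
  have h1 := h.sub_diagonal (k := fun _ => x) fun _ => hx
  rw [← smul_one_eq_diagonal] at h1
  rw [← neg_sub A, ← h1.integral_dotProduct_exp]
  refine integral_congr_ae (.of_forall fun t => ?_)
  have e : t • (A - x • (1 : Matrix n n ℝ)) = t • A - (x * t) • (1 : Matrix n n ℝ) := by
    rw [smul_sub, smul_smul, mul_comm]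
  simp only [e, exp_sub_smul_one, smul_mulVec, dotProduct_smul, smul_eq_mul]
  ring

end Matrix.IsStableMetzler

/-! ### Elimination of the states without first reward -/

namespace Kulkarni

theorem sum_EZero_add_sum_EPlus {E : Type u} [Fintype E] {r : E → ℝ}
    (hr : ∀ i, 0 ≤ r i) (f : E → ℝ) :
    ∑ i : EZero r, f i + ∑ i : EPlus r, f i = ∑ i, f i := by
  classical
  rw [← Fintype.sum_subtype_add_sum_subtype (fun i => r i = 0) f]
  congr 1
  exact Fintype.sum_equiv (Equiv.subtypeEquivRight fun i => (hr i).lt_iff_ne'.trans Iff.rfl) _ _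
    fun _ => rfl

section Blocks

variable {E : Type u} [Fintype E] [DecidableEq E] {α : E → ℝ} {Q : Matrix E E ℝ}
  {R : Matrix (Fin 2) E ℝ} {s : ℝ}

namespace IsParameter

theorem isStableMetzler {k : ℕ} {R : Matrix (Fin k) E ℝ} (h : IsParameter α Q R) :
    IsStableMetzler Q (-(Q⁻¹ *ᵥ 1)) :=
  isStableMetzler_of_rowSum_nonpos h.offDiag_nonneg
    (fun i => by simpa [exitRate] using h.exitRate_nonneg i) h.isUnit_Q

theorem isStableMetzler_Q00_sub (h : IsParameter α Q R) (hs : 0 ≤ s) :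
    IsStableMetzler (Q00 Q R - s • D0 R) fun i => (-(Q⁻¹ *ᵥ 1)) i.1 := by
  have := (h.isStableMetzler.submatrix (f := fun j : EZero (R 0) => j.1)
    Subtype.val_injective).sub_diagonal (k := fun j => s * R 1 j.1)
    fun j => mul_nonneg hs (h.reward_nonneg 1 j.1)
  have e : s • D0 R = diagonal fun j => s * R 1 j.1 := by
    rw [D0, ← diagonal_smul]; rfl
  rw [e]
  exact this

theorem isUnit_smul_D0_sub (h : IsParameter α Q R) (hs : 0 ≤ s) :
    IsUnit (s • D0 R - Q00 Q R) := by
  simpa using (h.isStableMetzler_Q00_sub hs).isUnit_neg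

theorem Q0P_nonneg (h : IsParameter α Q R) (i : EZero (R 0)) (j : EPlus (R 0)) :
    0 ≤ Q0P Q R i j :=
  h.offDiag_nonneg _ _ fun hij => j.2.ne' ((congrArg (R 0) hij).symm.trans i.2)

theorem QP0_nonneg (h : IsParameter α Q R) (i : EPlus (R 0)) (j : EZero (R 0)) :
    0 ≤ QP0 Q R i j :=
  h.offDiag_nonneg _ _ fun hij => i.2.ne' ((congrArg (R 0) hij).trans j.2)

theorem isUnit_RP : IsUnit (RP R) := by
  rw [isUnit_iff_isUnit_det, RP, det_diagonal, isUnit_iff_ne_zero]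
  exact Finset.prod_ne_zero_iff.2 fun j _ => j.2.ne'

theorem RP_inv : (RP R)⁻¹ = diagonal fun j => (R 0 j.1)⁻¹ := by
  refine inv_eq_left_inv ?_
  rw [RP, diagonal_mul_diagonal, ← diagonal_one]
  congr 1
  ext j
  exact inv_mul_cancel₀ j.2.ne'

/-- `W(s)` is a positive row scaling of the Schur complement of `Q - s diag(R 1)` on `E₊`, and the
restrictions of the vector for `Q` serve as witnesses on both blocks. -/
theorem isStableMetzler_W (h : IsParameter α Q R) (hs : 0 ≤ s) :
    IsStableMetzler (W Q R s) fun i => (-(Q⁻¹ *ᵥ 1)) i.1 := by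
  have hQ := h.isStableMetzler
  have hsum : ∀ i : E, ∑ j : EZero (R 0), Q i j * (-(Q⁻¹ *ᵥ 1)) j
      + ∑ j : EPlus (R 0), Q i j * (-(Q⁻¹ *ᵥ 1)) j < 0 := fun i => by
    rw [sum_EZero_add_sum_EPlus (h.reward_nonneg 0) fun j => Q i j * (-(Q⁻¹ *ᵥ 1)) j]
    exact hQ.mulVec_neg i
  have hd : ∀ i, 0 ≤ s * R 1 i * (-(Q⁻¹ *ᵥ 1)) i := fun i =>
    mul_nonneg (mul_nonneg hs (h.reward_nonneg 1 i)) (hQ.pos i).le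
  rw [W, RP_inv]
  refine IsStableMetzler.diagonal_mul ?_ fun i => inv_pos.2 i.2
  refine (h.isStableMetzler_Q00_sub hs).schurComplement h.Q0P_nonneg h.QP0_nonneg
    (fun i j hij => ?_) (fun i => hQ.pos i) (fun i => ?_) (fun i => ?_)
  · simpa [DP, diagonal_apply, hij, QPP] using
      h.offDiag_nonneg i.1 j.1 (Subtype.val_injective.ne hij)
  · have e : (Q00 Q R *ᵥ fun i : EZero (R 0) => (-(Q⁻¹ *ᵥ 1)) i.1) i
        + (Q0P Q R *ᵥ fun i : EPlus (R 0) => (-(Q⁻¹ *ᵥ 1)) i.1) i < 0 := hsum i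
    have e2 := hd i
    rw [Pi.add_apply, sub_mulVec, Pi.sub_apply, smul_mulVec, Pi.smul_apply, D0, mulVec_diagonal,
      smul_eq_mul]
    linarith
  · have e : (QP0 Q R *ᵥ fun i : EZero (R 0) => (-(Q⁻¹ *ᵥ 1)) i.1) i
        + (QPP Q R *ᵥ fun i : EPlus (R 0) => (-(Q⁻¹ *ᵥ 1)) i.1) i < 0 := hsum i
    have e2 := hd i
    rw [Pi.add_apply, sub_mulVec, Pi.sub_apply, smul_mulVec, Pi.smul_apply, DP, mulVec_diagonal,
      smul_eq_mul]
    linarith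

theorem inv_smul_D0_sub_nonneg (h : IsParameter α Q R) (hs : 0 ≤ s) (i j : EZero (R 0)) :
    0 ≤ (s • D0 R - Q00 Q R)⁻¹ i j := by
  simpa using (h.isStableMetzler_Q00_sub hs).neg_inv_apply_nonneg i j

/-- Nonnegativity is needed because the atom, like the density below, enters a measure through
`ENNReal.ofReal`, which truncates negative values. -/
theorem atom_nonneg (h : IsParameter α Q R) (hs : 0 ≤ s) :
    0 ≤ (1 - ∑ i, α i) + alpha0 α R ⬝ᵥ ((s • D0 R - Q00 Q R)⁻¹ *ᵥ eta0 Q R) :=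
  add_nonneg (sub_nonneg.2 h.initial_sum_le_one)
    (Finset.sum_nonneg fun i _ => mul_nonneg (h.initial_nonneg i)
      (mulVec_nonneg_of_nonneg (h.inv_smul_D0_sub_nonneg hs)
        (fun j => h.exitRate_nonneg j.1) i))

theorem alphaS_nonneg (h : IsParameter α Q R) (hs : 0 ≤ s) (i : EPlus (R 0)) :
    0 ≤ alphaS α Q R s i :=
  add_nonneg (Finset.sum_nonneg fun j _ => mul_nonneg (h.initial_nonneg j)
    (Finset.sum_nonneg fun l _ =>
      mul_nonneg (h.inv_smul_D0_sub_nonneg hs j l) (h.Q0P_nonneg l i))) (h.initial_nonneg i)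

theorem etaS_nonneg (h : IsParameter α Q R) (hs : 0 ≤ s) (i : EPlus (R 0)) :
    0 ≤ etaS Q R s i := by
  rw [etaS, RP_inv, mulVec_diagonal]
  refine mul_nonneg (inv_nonneg.2 i.2.le) (add_nonneg ?_ (h.exitRate_nonneg i))
  exact mulVec_nonneg_of_nonneg (fun i j => Finset.sum_nonneg fun l _ =>
    mul_nonneg (h.QP0_nonneg i l) (h.inv_smul_D0_sub_nonneg hs l j))
    (fun j => h.exitRate_nonneg j.1) i

theorem ae_density_nonneg (h : IsParameter α Q R) (hs : 0 ≤ s) :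
    ∀ᵐ y ∂(volume.restrict (Set.Ioi (0 : ℝ))),
      0 ≤ alphaS α Q R s ⬝ᵥ (NormedSpace.exp (y • W Q R s) *ᵥ etaS Q R s) :=
  (ae_restrict_iff' measurableSet_Ioi).2 (.of_forall fun _ hy =>
    Finset.sum_nonneg fun i _ => mul_nonneg (h.alphaS_nonneg hs i)
      (mulVec_nonneg_of_nonneg ((h.isStableMetzler_W hs).exp_smul_apply_nonneg (le_of_lt hy))
        (h.etaS_nonneg hs) i))

/-- Block elimination of the states with vanishing first reward in the resolvent formula. -/
theorem dotProduct_inv_mulVec_exitRate (h : IsParameter α Q R) (hs : 0 ≤ s) {x : ℝ} (hx : 0 ≤ x) :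
    α ⬝ᵥ ((diagonal (x • R 0 + s • R 1) - Q)⁻¹ *ᵥ exitRate Q)
      = alpha0 α R ⬝ᵥ ((s • D0 R - Q00 Q R)⁻¹ *ᵥ eta0 Q R)
        + alphaS α Q R s ⬝ᵥ ((x • (1 : Matrix (EPlus (R 0)) (EPlus (R 0)) ℝ) - W Q R s)⁻¹ *ᵥ
          etaS Q R s) := by
  have hk : ∀ i, 0 ≤ (x • R 0 + s • R 1) i := fun i =>
    add_nonneg (mul_nonneg hx (h.reward_nonneg 0 i)) (mul_nonneg hs (h.reward_nonneg 1 i))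
  have hK : IsUnit (diagonal (x • R 0 + s • R 1) - Q).det := by
    rw [← isUnit_iff_isUnit_det]
    simpa using (h.isStableMetzler.sub_diagonal hk).isUnit_neg
  have hB : IsUnit (s • D0 R - Q00 Q R).det :=
    (isUnit_iff_isUnit_det _).1 (h.isUnit_smul_D0_sub hs)
  have hWx : IsUnit (x • (1 : Matrix (EPlus (R 0)) (EPlus (R 0)) ℝ) - W Q R s).det := by
    rw [← isUnit_iff_isUnit_det, smul_one_eq_diagonal]
    simpa using ((h.isStableMetzler_W hs).sub_diagonal (k := fun _ => x) fun _ => hx).isUnit_neg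
  set B := s • D0 R - Q00 Q R with hBdef
  have hBneg : (Q00 Q R - s • D0 R)⁻¹ = -B⁻¹ := by
    refine inv_eq_left_inv ?_
    rw [← neg_sub (s • D0 R), ← hBdef, neg_mul_neg, nonsing_inv_mul _ hB]
  -- The solution of `(diagonal k - Q) z = η` is built by blocks: `p` solves the reduced system on
  -- `E₊`, and `q` is the back-substitution on `E₀`.
  obtain ⟨p, hp⟩ : ∃ p, p = (x • (1 : Matrix (EPlus (R 0)) (EPlus (R 0)) ℝ) - W Q R s)⁻¹ *ᵥ
    etaS Q R s := ⟨_, rfl⟩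
  obtain ⟨q, hq⟩ : ∃ q, q = B⁻¹ *ᵥ (eta0 Q R + Q0P Q R *ᵥ p) := ⟨_, rfl⟩
  have hp1 : x • p - W Q R s *ᵥ p = etaS Q R s := by
    have : (x • (1 : Matrix (EPlus (R 0)) (EPlus (R 0)) ℝ) - W Q R s) *ᵥ p = etaS Q R s := by
      rw [hp, mulVec_mulVec, mul_nonsing_inv _ hWx, one_mulVec]
    rwa [sub_mulVec, smul_mulVec, one_mulVec] at this
  have hRdet := (isUnit_iff_isUnit_det _).1 (isUnit_RP (R := R))
  -- Multiplication by `R₊` clears the factor `R₊⁻¹` in `W(s)` and `η(s)`; the `E₀` contributions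
  -- regroup into `q`.
  have hp2 : x • (RP R *ᵥ p) - (QPP Q R *ᵥ p - s • (DP R *ᵥ p)) - QP0 Q R *ᵥ q = etaP Q R := by
    have e := congrArg (RP R *ᵥ ·) hp1
    simp only [mulVec_sub, mulVec_smul] at e
    rw [W, etaS, mulVec_mulVec, mulVec_mulVec, ← Matrix.mul_assoc, mul_nonsing_inv _ hRdet,
      Matrix.one_mul, one_mulVec, hBneg, Matrix.mul_neg, Matrix.neg_mul, sub_neg_eq_add,
      add_mulVec, sub_mulVec, smul_mulVec] at e
    rw [hq, mulVec_mulVec, mulVec_add, mulVec_mulVec, ← sub_eq_zero]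
    rw [← sub_eq_zero] at e
    rw [← e]
    abel
  have hq1 : s • (D0 R *ᵥ q) - Q00 Q R *ᵥ q - Q0P Q R *ᵥ p = eta0 Q R := by
    have : B *ᵥ q = eta0 Q R + Q0P Q R *ᵥ p := by
      rw [hq, mulVec_mulVec, mul_nonsing_inv _ hB, one_mulVec]
    rw [hBdef, sub_mulVec, smul_mulVec] at this
    rw [this, add_sub_cancel_right]
  let z : E → ℝ := fun i => if hi : R 0 i = 0 then q ⟨i, hi⟩ else
    p ⟨i, (h.reward_nonneg 0 i).lt_of_ne' hi⟩
  have hz0 : ∀ i : EZero (R 0), z i = q i := fun i => dif_pos i.2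
  have hzp : ∀ i : EPlus (R 0), z i = p i := fun i => dif_neg i.2.ne'
  have hsum : ∀ f : E → ℝ, ∑ i, f i * z i
      = ∑ i : EZero (R 0), f i * q i + ∑ i : EPlus (R 0), f i * p i := fun f => by
    rw [← sum_EZero_add_sum_EPlus (h.reward_nonneg 0) fun i => f i * z i]
    simp only [hz0, hzp]
  have hz : (diagonal (x • R 0 + s • R 1) - Q) *ᵥ z = exitRate Q := by
    ext i
    have hi : (Q *ᵥ z) i = _ := hsum (Q i)
    rw [sub_mulVec, Pi.sub_apply, mulVec_diagonal, hi]
    by_cases h0 : R 0 i = 0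
    · have e := congrFun hq1 ⟨i, h0⟩
      simp only [D0, Pi.sub_apply, Pi.smul_apply, mulVec_diagonal, smul_eq_mul] at e
      change s * (R 1 i * q ⟨i, h0⟩) - ∑ j : EZero (R 0), Q i j * q j
        - ∑ j : EPlus (R 0), Q i j * p j = exitRate Q i at e
      rw [show z i = q ⟨i, h0⟩ from hz0 ⟨i, h0⟩, ← e]
      simp only [Pi.add_apply, Pi.smul_apply, smul_eq_mul, h0]
      ring
    · have hpos : 0 < R 0 i := (h.reward_nonneg 0 i).lt_of_ne' h0
      have e := congrFun hp2 ⟨i, hpos⟩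
      simp only [RP, DP, Pi.sub_apply, Pi.smul_apply, mulVec_diagonal, smul_eq_mul] at e
      change x * (R 0 i * p ⟨i, hpos⟩) - (∑ j : EPlus (R 0), Q i j * p j
        - s * (R 1 i * p ⟨i, hpos⟩)) - ∑ j : EZero (R 0), Q i j * q j = exitRate Q i at e
      rw [show z i = p ⟨i, hpos⟩ from hzp ⟨i, hpos⟩, ← e]
      simp only [Pi.add_apply, Pi.smul_apply, smul_eq_mul]
      ring
  have hinv : (diagonal (x • R 0 + s • R 1) - Q)⁻¹ *ᵥ exitRate Q = z := by
    rw [← hz, mulVec_mulVec, nonsing_inv_mul _ hK, one_mulVec]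
  rw [hinv, ← hp]
  have e : α ⬝ᵥ z = alpha0 α R ⬝ᵥ q + alphaP α R ⬝ᵥ p := hsum α
  rw [e, hq, mulVec_add, dotProduct_add, alphaS, add_dotProduct, mulVec_mulVec,
    dotProduct_mulVec _ (B⁻¹ * Q0P Q R)]
  ring

end IsParameter

end Blocks

end Kulkarni

/-! ### Identification of the weighted law -/

namespace MeasureTheory

variable {X : Type*} [MeasurableSpace X] {μ : Measure X} {f : X → ℝ}

theorem integral_withDensity_ofReal (hf : Measurable f) (h0 : ∀ᵐ x ∂μ, 0 ≤ f x) (g : X → ℝ) :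
    ∫ x, g x ∂(μ.withDensity fun x => ENNReal.ofReal (f x)) = ∫ x, f x * g x ∂μ := by
  rw [integral_withDensity_eq_integral_toReal_smul hf.ennreal_ofReal
    (.of_forall fun _ => ENNReal.ofReal_lt_top)]
  refine integral_congr_ae ?_
  filter_upwards [h0] with x hx
  rw [ENNReal.toReal_ofReal hx, smul_eq_mul]

theorem measureReal_withDensity_ofReal (hf : Measurable f) (h0 : ∀ᵐ x ∂μ, 0 ≤ f x) {B : Set X}
    (hB : MeasurableSet B) :
    (μ.withDensity fun x => ENNReal.ofReal (f x)).real B = ∫ x in B, f x ∂μ := by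
  rw [integral_eq_lintegral_of_nonneg_ae (ae_restrict_of_ae h0) hf.aestronglyMeasurable,
    Measure.real, withDensity_apply _ hB]

end MeasureTheory

namespace Kulkarni

variable {E : Type u} [Fintype E] [DecidableEq E] {α : E → ℝ} {Q : Matrix E E ℝ}
  {R : Matrix (Fin 2) E ℝ} {Ω : Type w} [MeasurableSpace Ω] {P : Measure Ω}
  [IsProbabilityMeasure P] {Z₁ Z₂ : Ω → ℝ}

theorem IsMPHStar.ae_nonneg (hZ₁ : Measurable Z₁) (hZ₂ : Measurable Z₂)
    (h : IsMPHStar.{u, v} (P.map fun ω => ![Z₁ ω, Z₂ ω]) α Q R) :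
    ∀ᵐ ω ∂P, 0 ≤ Z₁ ω ∧ 0 ≤ Z₂ ω := by
  obtain ⟨hp, Ω', _, P', _, J, hJ, hmap⟩ := h
  have hm : Measurable fun ω => ![Z₁ ω, Z₂ ω] :=
    measurable_pi_iff.2 fun i => by fin_cases i; exacts [hZ₁, hZ₂]
  -- `Measure.map` of a function that is not almost everywhere measurable is `0` by convention,
  -- whereas here it is a probability law; measurability of the rewards follows.
  have hm' : AEMeasurable (fun ω l => accumulatedReward (R l) J ω) P' :=
    .of_map_ne_zero (hmap ▸ (Measure.map_ne_zero_iff hm.aemeasurable).2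
      (IsProbabilityMeasure.ne_zero P))
  have hset : MeasurableSet {x : Fin 2 → ℝ | 0 ≤ x 0 ∧ 0 ≤ x 1} :=
    (measurableSet_le measurable_const (measurable_pi_apply 0)).inter
      (measurableSet_le measurable_const (measurable_pi_apply 1))
  have h1 : ∀ᵐ x ∂(P.map fun ω => ![Z₁ ω, Z₂ ω]), 0 ≤ x 0 ∧ 0 ≤ x 1 := by
    rw [hmap, ae_map_iff hm' hset]
    exact .of_forall fun ω => ⟨accumulatedReward_nonneg (hp.reward_nonneg 0) J ω,
      accumulatedReward_nonneg (hp.reward_nonneg 1) J ω⟩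
  simpa using (ae_map_iff hm.aemeasurable hset).1 h1

theorem IsMPHStar.integrable_exp_neg_mul (hZ₁ : Measurable Z₁) (hZ₂ : Measurable Z₂)
    (h : IsMPHStar.{u, v} (P.map fun ω => ![Z₁ ω, Z₂ ω]) α Q R) {s : ℝ} (hs : 0 ≤ s) :
    Integrable (fun ω => Real.exp (-s * Z₂ ω)) P := by
  refine Integrable.of_bound (by fun_prop) 1 ?_
  filter_upwards [h.ae_nonneg hZ₁ hZ₂] with ω hω
  rw [Real.norm_eq_abs, Real.abs_exp]
  exact Real.exp_le_one_iff.2 (by rw [neg_mul]; exact neg_nonpos.2 (mul_nonneg hs hω.2))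

theorem IsMPHStar.integral_exp_neg (hZ₁ : Measurable Z₁) (hZ₂ : Measurable Z₂)
    (h : IsMPHStar.{u, v} (P.map fun ω => ![Z₁ ω, Z₂ ω]) α Q R) {x s : ℝ} (hx : 0 ≤ x)
    (hs : 0 ≤ s) :
    ∫ ω, Real.exp (-s * Z₂ ω) * Real.exp (-(x * Z₁ ω)) ∂P
      = (1 - ∑ i, α i) + α ⬝ᵥ ((diagonal (x • R 0 + s • R 1) - Q)⁻¹ *ᵥ exitRate Q) := by
  obtain ⟨hp, Ω', _, P', _, J, hJ, hmap⟩ := h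
  have hm : Measurable fun ω => ![Z₁ ω, Z₂ ω] :=
    measurable_pi_iff.2 fun i => by fin_cases i; exacts [hZ₁, hZ₂]
  have hm' : AEMeasurable (fun ω l => accumulatedReward (R l) J ω) P' :=
    .of_map_ne_zero (hmap ▸ (Measure.map_ne_zero_iff hm.aemeasurable).2
      (IsProbabilityMeasure.ne_zero P))
  have hg : Measurable fun y : Fin 2 → ℝ => Real.exp (-s * y 1) * Real.exp (-(x * y 0)) := by
    fun_prop
  have e1 := integral_map hm.aemeasurable (hg.aestronglyMeasurable (μ := P.map _))
  have e2 := integral_map hm' (hg.aestronglyMeasurable (μ := P'.map _))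
  rw [← hmap, e1] at e2
  refine Eq.trans (by simp) (e2.trans ?_)
  have hk : ∀ i, 0 ≤ (x • R 0 + s • R 1) i := fun i =>
    add_nonneg (mul_nonneg hx (hp.reward_nonneg 0 i)) (mul_nonneg hs (hp.reward_nonneg 1 i))
  rw [← hJ.integral_exp_neg_accumulatedReward hp.isStableMetzler hk]
  refine integral_congr_ae ?_
  filter_upwards [hJ.ae_accumulatedReward_add_smul hp.isStableMetzler (R 0) (R 1) x s] with ω hω
  rw [hω, ← Real.exp_add]
  congr 1
  ring

/-- The law of `Z₁` weighted by `e^{-s Z₂}` is the sum of an atom at zero and a matrix-exponential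
density. -/
theorem IsMPHStar.map_withDensity_eq (hZ₁ : Measurable Z₁) (hZ₂ : Measurable Z₂)
    (h : IsMPHStar.{u, v} (P.map fun ω => ![Z₁ ω, Z₂ ω]) α Q R) {s : ℝ} (hs : 0 ≤ s) :
    (P.withDensity fun ω => ENNReal.ofReal (Real.exp (-s * Z₂ ω))).map Z₁ =
      ENNReal.ofReal ((1 - ∑ i, α i) +
          alpha0 α R ⬝ᵥ ((s • D0 R - Q00 Q R)⁻¹ *ᵥ eta0 Q R)) • Measure.dirac 0 +
        (volume.restrict (Set.Ioi 0)).withDensity fun y : ℝ => ENNReal.ofReal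
          (alphaS α Q R s ⬝ᵥ (NormedSpace.exp (y • W Q R s) *ᵥ etaS Q R s)) := by
  have hp := h.1
  have hW := hp.isStableMetzler_W hs
  have hnn := h.ae_nonneg hZ₁ hZ₂
  have hexp : Measurable fun ω => Real.exp (-s * Z₂ ω) := by fun_prop
  have hexpi := h.integrable_exp_neg_mul hZ₁ hZ₂ hs
  set f : ℝ → ℝ := fun y => alphaS α Q R s ⬝ᵥ (NormedSpace.exp (y • W Q R s) *ᵥ etaS Q R s)
    with hf
  have hfm : Measurable f := (continuous_dotProduct_exp_smul_mulVec _ _ _).measurable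
  have hfi : IntegrableOn f (Set.Ioi 0) := hW.integrableOn_dotProduct_exp _ _
  have hf0 : ∀ᵐ y ∂(volume.restrict (Set.Ioi (0 : ℝ))), 0 ≤ f y := hp.ae_density_nonneg hs
  have hfin1 : IsFiniteMeasure (P.withDensity fun ω => ENNReal.ofReal (Real.exp (-s * Z₂ ω))) :=
    isFiniteMeasure_withDensity_ofReal hexpi.hasFiniteIntegral
  have hfin2 : IsFiniteMeasure
      ((volume.restrict (Set.Ioi 0)).withDensity fun y : ℝ => ENNReal.ofReal (f y)) :=
    isFiniteMeasure_withDensity_ofReal hfi.hasFiniteIntegral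
  have hfin3 : IsFiniteMeasure (ENNReal.ofReal ((1 - ∑ i, α i) +
      alpha0 α R ⬝ᵥ ((s • D0 R - Q00 Q R)⁻¹ *ᵥ eta0 Q R)) • Measure.dirac (0 : ℝ)) :=
    Measure.smul_finite _ ENNReal.ofReal_ne_top
  have hnn2 : ∀ᵐ y ∂((volume.restrict (Set.Ioi 0)).withDensity fun y : ℝ =>
      ENNReal.ofReal (f y)), 0 ≤ y :=
    (withDensity_absolutelyContinuous _ _).ae_le
      ((ae_restrict_iff' measurableSet_Ioi).2 (.of_forall fun y hy => le_of_lt hy))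
  -- Both sides live on `[0, ∞)`; at `x = n` the left transform is the resolvent formula, and block
  -- elimination matches it with atom plus density.
  refine Measure.ext_of_integral_exp_neg_nat_of_nonneg ?_ ?_ fun n => ?_
  · rw [ae_map_iff hZ₁.aemeasurable measurableSet_Ici]
    exact (withDensity_absolutelyContinuous _ _).ae_le (hnn.mono fun ω hω => hω.1)
  · refine ae_add_measure_iff.2 ⟨Measure.ae_smul_measure ?_ _, hnn2⟩
    simp [ae_dirac_eq]
  · have hb : ∀ᵐ y ∂((volume.restrict (Set.Ioi 0)).withDensity fun y : ℝ =>
        ENNReal.ofReal (f y)), ‖Real.exp (-(n * y))‖ ≤ 1 := hnn2.mono fun y hy => by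
      rw [Real.norm_eq_abs, Real.abs_exp]
      exact Real.exp_le_one_iff.2 (neg_nonpos.2 (mul_nonneg (Nat.cast_nonneg n) hy))
    rw [integral_map hZ₁.aemeasurable (by fun_prop),
      integral_withDensity_ofReal hexp (.of_forall fun ω => (Real.exp_pos _).le),
      h.integral_exp_neg hZ₁ hZ₂ (Nat.cast_nonneg n) hs,
      integral_add_measure ((integrable_dirac (by simp)).smul_measure ENNReal.ofReal_ne_top)
        (Integrable.of_bound (by fun_prop) 1 hb),
      integral_smul_measure, integral_dirac, integral_withDensity_ofReal hfm hf0,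
      hW.integral_exp_neg_mul_dotProduct_exp _ _ (Nat.cast_nonneg n),
      hp.dotProduct_inv_mulVec_exitRate hs (Nat.cast_nonneg n),
      ENNReal.toReal_ofReal (hp.atom_nonneg hs)]
    simp [add_assoc]

end Kulkarni

theorem mainTheorem1 {E : Type u} [Fintype E] [DecidableEq E]
    (α : E → ℝ) (Q : Matrix E E ℝ) (R : Matrix (Fin 2) E ℝ)
    {Ω : Type w} [MeasurableSpace Ω] (P : Measure Ω) [IsProbabilityMeasure P]
    (Z₁ Z₂ : Ω → ℝ) (hZ₁ : Measurable Z₁) (hZ₂ : Measurable Z₂)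
    (hZ : Kulkarni.IsMPHStar.{u, v} (P.map fun ω => ![Z₁ ω, Z₂ ω]) α Q R)
    (s : ℝ) (hs : 0 ≤ s) :
    -- the matrices inverted in the formulas are invertible, and the expectations exist
    IsUnit (s • Kulkarni.D0 R - Kulkarni.Q00 Q R) ∧
    IsUnit (Kulkarni.RP R) ∧
    Integrable (fun ω => Real.exp (-s * Z₂ ω)) P ∧
    -- the part on the event `Z₁ = 0`; `1 - ∑ i, α i` is the probability of starting absorbed
    ∫ ω in Z₁ ⁻¹' {0}, Real.exp (-s * Z₂ ω) ∂P =
      (1 - ∑ i, α i) +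
        Kulkarni.alpha0 α R ⬝ᵥ
          ((s • Kulkarni.D0 R - Kulkarni.Q00 Q R)⁻¹ *ᵥ Kulkarni.eta0 Q R) ∧
    -- the density on `y > 0`
    IntegrableOn
      (fun y : ℝ => Kulkarni.alphaS α Q R s ⬝ᵥ
        (NormedSpace.exp (y • Kulkarni.W Q R s) *ᵥ Kulkarni.etaS Q R s)) (Set.Ioi 0) ∧
    ∀ B : Set ℝ, MeasurableSet B → B ⊆ Set.Ioi 0 →
      ∫ ω in Z₁ ⁻¹' B, Real.exp (-s * Z₂ ω) ∂P =
        ∫ y in B, Kulkarni.alphaS α Q R s ⬝ᵥ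
          (NormedSpace.exp (y • Kulkarni.W Q R s) *ᵥ Kulkarni.etaS Q R s) := by
  have hp := hZ.1
  have hW := hp.isStableMetzler_W hs
  have hexp : Measurable fun ω => Real.exp (-s * Z₂ ω) := by fun_prop
  have hfm : Measurable fun y : ℝ => Kulkarni.alphaS α Q R s ⬝ᵥ
      (NormedSpace.exp (y • Kulkarni.W Q R s) *ᵥ Kulkarni.etaS Q R s) :=
    (continuous_dotProduct_exp_smul_mulVec _ _ _).measurable
  have hf0 : ∀ᵐ y ∂(volume.restrict (Set.Ioi (0 : ℝ))), 0 ≤ Kulkarni.alphaS α Q R s ⬝ᵥ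
      (NormedSpace.exp (y • Kulkarni.W Q R s) *ᵥ Kulkarni.etaS Q R s) :=
    hp.ae_density_nonneg hs
  have hlaw := hZ.map_withDensity_eq hZ₁ hZ₂ hs
  -- Each expectation is the mass of `B` under the weighted law, so evaluating the law on `{0}`
  -- isolates the atom, and on `B ⊆ (0, ∞)` the density.
  have hleft : ∀ B : Set ℝ, MeasurableSet B → ∫ ω in Z₁ ⁻¹' B, Real.exp (-s * Z₂ ω) ∂P
      = ((P.withDensity fun ω => ENNReal.ofReal (Real.exp (-s * Z₂ ω))).map Z₁).real B :=
    fun B hB => by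
      rw [map_measureReal_apply hZ₁ hB, measureReal_withDensity_ofReal hexp
        (.of_forall fun ω => (Real.exp_pos _).le) (hZ₁ hB)]
  refine ⟨hp.isUnit_smul_D0_sub hs, Kulkarni.IsParameter.isUnit_RP,
    hZ.integrable_exp_neg_mul hZ₁ hZ₂ hs, ?_, hW.integrableOn_dotProduct_exp _ _, fun B hB hB0 => ?_⟩
  · rw [hleft _ (measurableSet_singleton 0), hlaw, Measure.real, Measure.add_apply,
      Measure.smul_apply, withDensity_apply _ (measurableSet_singleton 0),
      Measure.restrict_restrict (measurableSet_singleton 0)]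
    simp [ENNReal.toReal_ofReal (hp.atom_nonneg hs)]
  · have h0 : (0 : ℝ) ∉ B := fun h => lt_irrefl (0 : ℝ) (hB0 h)
    rw [← Set.inter_eq_left.2 hB0, ← Measure.restrict_restrict hB,
      ← measureReal_withDensity_ofReal hfm hf0 hB, Set.inter_eq_left.2 hB0, hleft B hB, hlaw,
      Measure.real, Measure.add_apply, Measure.smul_apply, Measure.dirac_apply' _ hB]
    simp [h0, Measure.real]
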